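/- Let $k_1,k_2\ge 0$ be integers such that either $k_1,k_2\ge 1$ or $k_1+k_2=1$; put $k=k_1+k_2$ and let $n\ge 4k$. Let $\xi_1,\dots,\xi_n$ be independent Bernoulli trials with $\mathbb P(\xi_l=1)=p=1-\mathbb P(\xi_l=0)$ for all $l$, and put $a(p)=(1-p)^{k_1}p^{k_2}$ and $$I_l=(1-\xi_l)\cdots(1-\xi_{l+k_1-1})\,\xi_{l+k_1}\cdots\xi_{l+k_1+k_2-1}.$$ Let $B^n_{k_1,k_2}=\sum_{l=1}^{n-k+1}I_l$ be the number of $(k_1,k_2)$-runs, and let $M=\sum_{l=1}^{n}I_l$, where in $M$ the indices of the trials are read modulo $n$ (so that $\xi_{n+l}$ means $\xi_l$). Let $\alpha>0$ and $0<\check p<1$, $\check q=1-\check p$, satisfy $$\alpha\check p=\mathbb E(M),\qquad \alpha\check p\check q=\mathrm{Var}(M),$$ and let $Z$ have the pseudo-binomial distribution with parameters $\alpha,\check p$, that is, $$\mathbb P(Z=m)=\frac1{\mathcal C}\binom{\alpha}{m}\check p^{\,m}\check q^{\,\alpha-m},\quad m=0,1,\dots,\lfloor\alpha\rfloor,\qquad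 \mathcal C=\sum_{m=0}^{\lfloor\alpha\rfloor}\binom{\alpha}{m}\check p^{\,m}\check q^{\,\alpha-m},$$ with $\binom{\alpha}{m}=\alpha(\alpha-1)\cdots(\alpha-m+1)/m!$. Let $d_{TV}(X,Y)=\sup_S|\mathbb P(X\in S)-\mathbb P(Y\in S)|$ denote the total variation distance between laws. Then $$d_{TV}(B^n_{k_1,k_2},Z)\le d_{TV}(B^n_{k_1,k_2},M)+d_{TV}(M,Z)$$ and $$d_{TV}(B^n_{k_1,k_2},M)+d_{TV}(M,Z)\le 2(k-1)a(p)\left(1\wedge\frac{2.3}{\sqrt{(n-k-1)\,a(p)\,(2p^3-p^4)}}\right)+\frac{n\,a(p)^2}{\lfloor\alpha\rfloor\check p\check q}\,(2k-1)\bigl(2(4k-3)a(p)+\check p\bigr)\left(2\wedge\frac{4.6}{\sqrt{(n-4k+2)\,a(p)\,(2p^3-p^4)}}\right).$$ -/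

import Mathlib

open MeasureTheory ProbabilityTheory

/-- The pattern indicator `(1 - x l) ⋯ (1 - x (l+k₁-1)) * x (l+k₁) ⋯ x (l+k₁+k₂-1)` of a
`0`-`1` sequence `x`. -/
def runIndicator (k₁ k₂ : ℕ) (x : ℕ → ℕ) (l : ℕ) : ℕ :=
  (∏ i ∈ Finset.range k₁, (1 - x (l + i))) * ∏ i ∈ Finset.range k₂, x (l + k₁ + i)

/-- The number of `(k₁, k₂)`-runs among the trials `x 1, …, x n`. -/
def runCount (k₁ k₂ n : ℕ) (x : ℕ → ℕ) : ℕ :=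
  ∑ l ∈ Finset.Icc 1 (n + 1 - (k₁ + k₂)), runIndicator k₁ k₂ x l

/-- The number of `(k₁, k₂)`-runs among the trials `x 1, …, x n` placed on a circle: an index
`j ≥ 1` is replaced by the element of `{1, …, n}` congruent to it modulo `n`. -/
def cyclicRunCount (k₁ k₂ n : ℕ) (x : ℕ → ℕ) : ℕ :=
  ∑ l ∈ Finset.Icc 1 n, runIndicator k₁ k₂ (fun j => x ((j - 1) % n + 1)) l

/-- The total variation distance between the laws of `X` (under `μ`) and `Y` (under `ν`):
the supremum of `|P(X ∈ S) - P(Y ∈ S)|` over all measurable sets `S`. -/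
noncomputable def dTV {Ω Ω' E : Type*} [MeasurableSpace Ω] [MeasurableSpace Ω']
    [MeasurableSpace E] (μ : Measure Ω) (X : Ω → E) (ν : Measure Ω') (Y : Ω' → E) : ℝ :=
  ⨆ S : {S : Set E // MeasurableSet S}, |μ.real (X ⁻¹' S) - ν.real (Y ⁻¹' S)|

/-- The unnormalised pseudo-binomial weight `(α choose m) r ^ m (1 - r) ^ (α - m)`, with the
generalised binomial coefficient `α (α - 1) ⋯ (α - m + 1) / m!`. -/
noncomputable def pseudoBinomialWeight (α r : ℝ) (m : ℕ) : ℝ :=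
  Ring.choose α m * r ^ m * (1 - r) ^ (α - (m : ℝ))

/-- The probability mass function of the pseudo-binomial distribution with parameters `α`
and `r`, supported on `{0, 1, …, ⌊α⌋}`. -/
noncomputable def pseudoBinomialPMF (α r : ℝ) (m : ℕ) : ℝ :=
  if m ≤ ⌊α⌋₊ then
    pseudoBinomialWeight α r m / ∑ j ∈ Finset.range (⌊α⌋₊ + 1), pseudoBinomialWeight α r j
  else 0

/-! The pattern cannot overlap itself. Hence the count in N trials has a generating function L_N
(`runPoly`) with L_N = L_{N-1} + a(X-1)L_{N-k}, and the cyclic count M has T = L_n +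
(k-1)a(X-1)L_{n-k}, with T' = na L_{n-k}. So M has mean na and variance na(1-(2k-1)a), which forces
r = (2k-1)a for the success parameter r of Z, and both distances reduce to pairings of bounded
functions with (X-1)L_N.

Smoothing: L_N has only real roots (`splits_runPoly`), so, its coefficients being nonnegative, it is
the law of a sum of independent Bernoulli variables. The successive differences of such a law change
sign once and its masses are at most 1/σ (`IsPoissonBinomial.coeff_le`); together with (2k-1)a ≤ 8/9
for k ≥ 2 this gives `abs_pairing_X_sub_one_mul_runPoly_le`. The distance between B and M follows at
once, since L_n - T is a multiple of (X-1)L_{n-k}.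

For M and Z, Stein's method is used. The pseudo-binomial law is stationary for a birth-death chain
on {0, …, ⌊α⌋}, and the increments of the Stein solution are at most 1/(⌊α⌋ r (1-r)). Because two
moments match, pairing the Stein operator with T leaves a multiple of (X-1)²
(`pairing_stein_operator_cyclicRunPoly`): one factor becomes an increment of the solution, the other
is smoothed. The Stein equation fails beyond ⌊α⌋, which costs P(M > ⌊α⌋), bounded by a factorial
moment or by Chebyshev.

These bounds do not involve 2p³ - p⁴; for k ≥ 2 that quantity lies in (0,1] and only enlarges the
stated right-hand side. For k = 1 both distances vanish. -/

/-! ### Generating functions of linear and cyclic run counts. -/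

section RunPolynomials
open Polynomial

/-- The probability generating function of the number of occurrences, in `N` independent trials,
of a pattern of length `k` and probability `a` that cannot overlap itself. -/
noncomputable def runPoly (a : ℝ) (k : ℕ) : ℕ → ℝ[X]
  | 0 => 1
  | N + 1 => if N + 1 < k then 1 else
      runPoly a k N + C a * (X - 1) * runPoly a k (N - (k - 1))

/-- The probability generating function of the number of occurrences of such a pattern in `N`
trials on a circle. -/
noncomputable def cyclicRunPoly (a : ℝ) (k n : ℕ) : ℝ[X] :=
  runPoly a k n + C ((k - 1) * a) * (X - 1) * runPoly a k (n - k)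

/-- The expectation of `f` under the signed measure on `ℕ` with generating function `q`. -/
noncomputable def pairing (f : ℕ → ℝ) : ℝ[X] →ₗ[ℝ] ℝ :=
  Polynomial.lsum fun m => LinearMap.mulRight ℝ (f m)

theorem pairing_monomial (f : ℕ → ℝ) (m : ℕ) (c : ℝ) : pairing f (monomial m c) = c * f m := by
  simp [pairing, Polynomial.lsum_apply, Polynomial.sum_monomial_index]

theorem pairing_eq_sum (f : ℕ → ℝ) (q : ℝ[X]) {n : ℕ} (hn : q.natDegree < n) :
    pairing f q = ∑ m ∈ Finset.range n, q.coeff m * f m := by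
  simp [pairing, Polynomial.lsum_apply]
  exact Polynomial.sum_over_range' q (by simp) n hn

theorem pairing_X_mul (f : ℕ → ℝ) (q : ℝ[X]) :
    pairing f (X * q) = pairing (fun m => f (m + 1)) q := by
  induction q using Polynomial.induction_on' with
  | add p q hp hq => simp [mul_add, hp, hq]
  | monomial m c => rw [X_mul_monomial, pairing_monomial, pairing_monomial]

theorem pairing_add_fun (f g : ℕ → ℝ) (q : ℝ[X]) :
    pairing (fun m => f m + g m) q = pairing f q + pairing g q := by
  induction q using Polynomial.induction_on' with
  | add p q hp hq => simp only [map_add, hp, hq]; ring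
  | monomial m c => simp only [pairing_monomial]; ring

theorem pairing_const_mul_fun (c : ℝ) (f : ℕ → ℝ) (q : ℝ[X]) :
    pairing (fun m => c * f m) q = c * pairing f q := by
  induction q using Polynomial.induction_on' with
  | add p q hp hq => simp only [map_add, hp, hq]; ring
  | monomial m c => simp only [pairing_monomial]; ring

theorem pairing_sub_fun (f g : ℕ → ℝ) (q : ℝ[X]) :
    pairing (fun m => f m - g m) q = pairing f q - pairing g q := by
  induction q using Polynomial.induction_on' with
  | add p q hp hq => simp only [map_add, hp, hq]; ring
  | monomial m c => simp only [pairing_monomial]; ring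

theorem pairing_C_mul (f : ℕ → ℝ) (c : ℝ) (q : ℝ[X]) :
    pairing f (C c * q) = c * pairing f q := by
  rw [← smul_eq_C_mul, map_smul, smul_eq_mul]

theorem pairing_X_sub_one_mul (f : ℕ → ℝ) (q : ℝ[X]) :
    pairing f ((X - 1) * q) = pairing (fun m => f (m + 1) - f m) q := by
  rw [sub_mul, one_mul, map_sub, pairing_X_mul, pairing_sub_fun]

theorem pairing_const (c : ℝ) (q : ℝ[X]) : pairing (fun _ => c) q = c * q.eval 1 := by
  induction q using Polynomial.induction_on' with
  | add p q hp hq => simp only [map_add, hp, hq, eval_add]; ring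
  | monomial m c => simp only [pairing_monomial, eval_monomial]; ring

theorem pairing_cast_mul (f : ℕ → ℝ) (q : ℝ[X]) :
    pairing (fun m => m * f m) q = pairing f (X * derivative q) := by
  induction q using Polynomial.induction_on' with
  | add p q hp hq => simp only [map_add, hp, hq, mul_add]
  | monomial m c =>
    rcases m with _ | m
    · rw [derivative_monomial, pairing_monomial]; simp
    · rw [derivative_monomial, X_mul_monomial, pairing_monomial, pairing_monomial]
      simp; ring

theorem pairing_single (q : ℝ[X]) (m : ℕ) :
    pairing (fun j => if j = m then 1 else 0) q = q.coeff m := by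
  induction q using Polynomial.induction_on' with
  | add p q hp hq => simp only [map_add, hp, hq, coeff_add]
  | monomial j c => rw [pairing_monomial, coeff_monomial]; split_ifs <;> simp

variable {a : ℝ} {k : ℕ}

theorem runPoly_of_lt {N : ℕ} (h : N < k) : runPoly a k N = 1 := by
  cases N with
  | zero => rw [runPoly]
  | succ N => rw [runPoly, if_pos h]

theorem runPoly_of_le (hk : 1 ≤ k) {N : ℕ} (h : k ≤ N) :
    runPoly a k N = runPoly a k (N - 1) + C a * (X - 1) * runPoly a k (N - k) := by
  obtain ⟨N, rfl⟩ : ∃ M, N = M + 1 := ⟨N - 1, by omega⟩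
  rw [runPoly, if_neg (by omega)]
  congr 3
  omega

theorem eval_one_runPoly (hk : 1 ≤ k) (N : ℕ) : (runPoly a k N).eval 1 = 1 := by
  induction N using Nat.strong_induction_on with
  | _ N ih =>
    rcases lt_or_ge N k with h | h
    · simp [runPoly_of_lt h]
    · rw [runPoly_of_le hk h]; simp [ih (N - 1) (by omega)]

theorem runPoly_add_sub (hk : 1 ≤ k) (N j : ℕ) (hN : k - 1 ≤ N) :
    runPoly a k (N + j) - runPoly a k N =
      C a * (X - 1) * ∑ i ∈ Finset.range j, runPoly a k (N + 1 + i - k) := by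
  induction j with
  | zero => simp
  | succ j ih =>
    rw [Finset.sum_range_succ, mul_add, ← ih, ← add_assoc, runPoly_of_le hk (by omega)]
    rw [show N + j + 1 - 1 = N + j by omega, show N + j + 1 - k = N + 1 + j - k by omega]
    ring

/-- Probabilistically, marking one occurrence on the circle leaves n positions, probability a, and a
line of n - k free trials. Algebraically, the cyclic polynomials obey the recurrence of the linear
ones once n ≥ 2k, and the formula passes through it; for k ≤ n < 2k everything is explicit. -/
theorem derivative_cyclicRunPoly (hk : 1 ≤ k) {n : ℕ} (hn : k ≤ n) :
    derivative (cyclicRunPoly a k n) = C (n * a) * runPoly a k (n - k) := by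
  induction n using Nat.strong_induction_on with
  | _ n ih =>
    rcases lt_or_ge n (2 * k) with h | h
    · have e : runPoly a k n = 1 + C a * (X - 1) * ((n - k + 1 : ℕ) : ℝ[X]) := by
        have := runPoly_add_sub (a := a) hk (k - 1) (n - k + 1) le_rfl
        rw [show k - 1 + (n - k + 1) = n by omega, runPoly_of_lt (N := k - 1) (by omega),
          Finset.sum_congr rfl (g := fun _ => 1)] at this
        · rw [← sub_eq_iff_eq_add', this]; simp
        · intro i hi
          rw [Finset.mem_range] at hi
          exact runPoly_of_lt (by omega)
      rw [cyclicRunPoly, e, runPoly_of_lt (N := n - k) (by omega)]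
      simp only [derivative_add, derivative_mul, derivative_sub, derivative_C, derivative_X,
        derivative_one, derivative_natCast, C_mul, C_sub, C_1, map_natCast]
      push_cast [Nat.cast_sub hn]
      ring
    · have h1 := ih (n - 1) (by omega) (by omega)
      have h2 := ih (n - k) (by omega) (by omega)
      have r1 := runPoly_of_le (a := a) hk (N := n) (by omega)
      have r2 := runPoly_of_le (a := a) hk (N := n - k) (by omega)
      have e : cyclicRunPoly a k n = cyclicRunPoly a k (n - 1)
          + C a * (X - 1) * cyclicRunPoly a k (n - k) := by
        simp only [cyclicRunPoly]
        rw [r1, r2, show n - k - 1 = n - 1 - k by omega]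
        ring
      rw [e, derivative_add, derivative_mul, h1, h2]
      simp only [cyclicRunPoly, derivative_mul, derivative_C, derivative_sub, derivative_X,
        derivative_one]
      rw [r2, show n - k - 1 = n - 1 - k by omega]
      simp only [C_mul, C_sub, C_1, map_natCast]
      push_cast [Nat.cast_sub (show 1 ≤ n by omega), Nat.cast_sub hn]
      ring

/-- Telescoping L_n down to L_{n-k} gives k first-order terms L_{n-k-j}; replacing each by L_{n-k}
makes k + (k-1) = 2k-1 copies in all, and each replacement error carries a second factor a(X-1). -/
theorem cyclicRunPoly_sub (hk : 1 ≤ k) {n : ℕ} (hn : 4 * k ≤ n) :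
    cyclicRunPoly a k n - runPoly a k (n - k)
        - C ((2 * k - 1) * a) * ((X - 1) * runPoly a k (n - k)) =
      - (C (a ^ 2) * ((X - 1) * ((X - 1) * ∑ j ∈ Finset.range k, ∑ i ∈ Finset.range j,
        runPoly a k (n - k - j + 1 + i - k)))) := by
  have h1 := runPoly_add_sub (a := a) hk (n - k) k (by omega)
  rw [show n - k + k = n by omega] at h1
  have h2 : ∑ i ∈ Finset.range k, runPoly a k (n - k + 1 + i - k)
      = ∑ j ∈ Finset.range k, runPoly a k (n - k - j) := by
    rw [← Finset.sum_range_reflect]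
    refine Finset.sum_congr rfl fun i hi => ?_
    rw [Finset.mem_range] at hi
    congr 1; omega
  have h3 : ∀ j ∈ Finset.range k, runPoly a k (n - k - j) = runPoly a k (n - k)
      - C a * (X - 1) * ∑ i ∈ Finset.range j, runPoly a k (n - k - j + 1 + i - k) := by
    intro j hj
    rw [Finset.mem_range] at hj
    have := runPoly_add_sub (a := a) hk (n - k - j) j (by omega)
    rw [show n - k - j + j = n - k by omega] at this
    rw [← this]; ring
  rw [h2, Finset.sum_congr rfl h3, Finset.sum_sub_distrib, ← Finset.mul_sum, Finset.sum_const,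
    Finset.card_range, nsmul_eq_mul] at h1
  rw [cyclicRunPoly, sub_eq_iff_eq_add.mp h1]
  simp only [C_mul, C_sub, C_1, map_natCast, C_pow, show (C 2 : ℝ[X]) = 2 from rfl]
  ring

theorem eval_one_derivative_runPoly (hk : 1 ≤ k) (N : ℕ) :
    (derivative (runPoly a k N)).eval 1 = a * (N + 1 - k : ℕ) := by
  induction N using Nat.strong_induction_on with
  | _ N ih =>
    rcases lt_or_ge N k with h | h
    · rw [runPoly_of_lt h, show N + 1 - k = 0 by omega]; simp
    · rw [runPoly_of_le hk h, show N + 1 - k = N - 1 + 1 - k + 1 by omega]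
      simp [ih (N - 1) (by omega), eval_one_runPoly hk]; ring

/-- The recurrence adds 2a times the mean for N - k trials at each step. That mean is a truncated
difference, hence at least its untruncated value, so only an inequality results; it bounds the
variance from below. -/
theorem le_eval_one_derivative_two_runPoly (hk : 1 ≤ k) {N : ℕ} (hN : k ≤ N + 1) :
    a ^ 2 * (((N + 1 - k : ℕ) : ℝ) ^ 2 - (2 * k - 1) * (N + 1 - k : ℕ)) ≤
      (derivative (derivative (runPoly a k N))).eval 1 := by
  induction N using Nat.strong_induction_on with
  | _ N ih =>
    rcases lt_or_ge N k with h | h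
    · rw [runPoly_of_lt h, show N + 1 - k = 0 by omega]; simp
    · have h1 := ih (N - 1) (by omega) (by omega)
      have h2 : ((N : ℝ) - k - k + 1) ≤ (N - k + 1 - k : ℕ) := by
        have : (N : ℤ) - k - k + 1 ≤ (N - k + 1 - k : ℕ) := by omega
        exact_mod_cast this
      have h3 := mul_le_mul_of_nonneg_left h2 (sq_nonneg a)
      rw [runPoly_of_le hk h]
      simp only [derivative_add, derivative_mul, derivative_C, derivative_sub, derivative_X,
        derivative_one, derivative_zero, eval_add, eval_mul, eval_sub, eval_C, eval_X, eval_one, eval_zero,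
        eval_one_derivative_runPoly hk]
      rw [show N - 1 + 1 - k = N - k by omega] at h1
      rw [show N + 1 - k = N - k + 1 by omega]
      push_cast [Nat.cast_sub h] at h1 ⊢
      linarith

end RunPolynomials

/-! ### Poisson-binomial laws: concentration and unimodality. -/

section Smoothing
open Polynomial

theorem pairing_mono {f g : ℕ → ℝ} {q : ℝ[X]} (hq : ∀ m, 0 ≤ q.coeff m) (h : ∀ m, f m ≤ g m) :
    pairing f q ≤ pairing g q := by
  rw [pairing_eq_sum f q (Nat.lt_succ_self _), pairing_eq_sum g q (Nat.lt_succ_self _)]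
  exact Finset.sum_le_sum fun m _ => mul_le_mul_of_nonneg_left (h m) (hq m)

theorem coeff_mul_nonneg {p q : ℝ[X]} (hp : ∀ m, 0 ≤ p.coeff m) (hq : ∀ m, 0 ≤ q.coeff m) (m : ℕ) :
    0 ≤ (p * q).coeff m := by
  rw [coeff_mul]
  exact Finset.sum_nonneg fun i _ => mul_nonneg (hp _) (hq _)

/-- The probability generating function of a Bernoulli law. -/
noncomputable def bernoulliPoly (r : ℝ) : ℝ[X] := C (1 - r) + C r * X

theorem coeff_bernoulliPoly_nonneg {r : ℝ} (h0 : 0 ≤ r) (h1 : r ≤ 1) (m : ℕ) :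
    0 ≤ (bernoulliPoly r).coeff m := by
  rw [bernoulliPoly, coeff_add, coeff_C, coeff_C_mul, coeff_X]
  split_ifs <;> simp <;> linarith

theorem eval_one_bernoulliPoly (r : ℝ) : (bernoulliPoly r).eval 1 = 1 := by simp [bernoulliPoly]

theorem derivative_bernoulliPoly (r : ℝ) : derivative (bernoulliPoly r) = C r := by
  simp [bernoulliPoly]

/-- `q` is the probability generating function of a sum of independent Bernoulli variables. -/
def IsPoissonBinomial (q : ℝ[X]) : Prop :=
  ∃ s : Multiset ℝ, (∀ r ∈ s, 0 ≤ r ∧ r ≤ 1) ∧ q = (s.map bernoulliPoly).prod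

/-- The variance of the law on `ℕ` with probability generating function `q`. -/
noncomputable def pgfVariance (q : ℝ[X]) : ℝ :=
  (derivative (derivative q)).eval 1 + (derivative q).eval 1 - (derivative q).eval 1 ^ 2

@[elab_as_elim]
theorem IsPoissonBinomial.induction {P : ℝ[X] → Prop} {q : ℝ[X]} (hq : IsPoissonBinomial q)
    (one : P 1)
    (mul : ∀ r q, 0 ≤ r → r ≤ 1 → P q → P (bernoulliPoly r * q)) : P q := by
  obtain ⟨s, hs, rfl⟩ := hq
  induction s using Multiset.induction_on with
  | empty => simpa using one
  | cons r s ih =>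
    rw [Multiset.map_cons, Multiset.prod_cons]
    have := hs r (Multiset.mem_cons_self _ _)
    exact mul _ _ this.1 this.2 (ih fun t ht => hs t (Multiset.mem_cons_of_mem ht))

theorem IsPoissonBinomial.coeff_nonneg {q : ℝ[X]} (hq : IsPoissonBinomial q) (m : ℕ) :
    0 ≤ q.coeff m := by
  revert m
  refine hq.induction ?_ ?_
  · intro m; rw [coeff_one]; split_ifs <;> norm_num
  · exact fun r q h0 h1 ih => coeff_mul_nonneg (coeff_bernoulliPoly_nonneg h0 h1) ih

theorem IsPoissonBinomial.eval_one {q : ℝ[X]} (hq : IsPoissonBinomial q) : q.eval 1 = 1 := by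
  refine hq.induction (by simp) ?_
  intro r q _ _ ih
  rw [eval_mul, eval_one_bernoulliPoly, ih, one_mul]

/-- Unimodality: multiplication by 1 - r + rX averages neighbouring differences, so a pattern of
nonpositive then nonnegative signs survives, and only the sign at the switching index is
undetermined. -/
theorem IsPoissonBinomial.sign_change {q : ℝ[X]} (hq : IsPoissonBinomial q) :
    ∃ n, (∀ j < n, ((X - 1) * q).coeff j ≤ 0) ∧ ∀ j, n ≤ j → 0 ≤ ((X - 1) * q).coeff j := by
  refine hq.induction ?_ ?_
  · refine ⟨1, fun j hj => ?_, fun j hj => ?_⟩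
    · simp [show j = 0 by omega]
    · rw [mul_one, coeff_sub, coeff_X, coeff_one, if_neg (show j ≠ 0 by omega)]
      split_ifs <;> norm_num
  · rintro r q h0 h1 ⟨n, hneg, hpos⟩
    have hc0 : ((X - 1) * (bernoulliPoly r * q)).coeff 0 = (1 - r) * ((X - 1) * q).coeff 0 := by
      simp [bernoulliPoly, mul_coeff_zero]
    have hc : ∀ j, ((X - 1) * (bernoulliPoly r * q)).coeff (j + 1) =
        (1 - r) * ((X - 1) * q).coeff (j + 1) + r * ((X - 1) * q).coeff j := by
      intro j
      rw [show (X - 1) * (bernoulliPoly r * q) =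
        C (1 - r) * ((X - 1) * q) + C r * (X * ((X - 1) * q)) by rw [bernoulliPoly]; ring,
        coeff_add, coeff_C_mul, coeff_C_mul, coeff_X_mul]
    have hr : 0 ≤ 1 - r := by linarith
    have key1 : ∀ j < n, ((X - 1) * (bernoulliPoly r * q)).coeff j ≤ 0 := by
      rintro (_ | j) hj
      · rw [hc0]; exact mul_nonpos_of_nonneg_of_nonpos hr (hneg _ hj)
      · rw [hc]
        exact add_nonpos (mul_nonpos_of_nonneg_of_nonpos hr (hneg _ hj))
          (mul_nonpos_of_nonneg_of_nonpos h0 (hneg _ (by omega)))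
    have key2 : ∀ j, n + 1 ≤ j → 0 ≤ ((X - 1) * (bernoulliPoly r * q)).coeff j := by
      rintro (_ | j) hj
      · omega
      · rw [hc]
        exact add_nonneg (mul_nonneg hr (hpos _ (by omega))) (mul_nonneg h0 (hpos _ (by omega)))
    rcases le_total 0 (((X - 1) * (bernoulliPoly r * q)).coeff n) with h | h
    · refine ⟨n, key1, fun j hj => ?_⟩
      rcases hj.eq_or_lt with rfl | hj
      · exact h
      · exact key2 j hj
    · refine ⟨n + 1, fun j hj => ?_, key2⟩
      rcases (Nat.lt_succ_iff.mp hj).eq_or_lt with rfl | hj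
      · exact h
      · exact key1 j hj

/-- Q is the unnormalised zero-bias law, with E[(W-μ)f(W)] = ∑ Q_m (f(m+1) - f(m)). A Bernoulli
factor b_r turns Q into r(1-r)q + b_r Q, and the last inequality persists because 1 + X - b_r =
b_{1-r} has nonnegative coefficients. -/
theorem IsPoissonBinomial.exists_zeroBias {q : ℝ[X]} (hq : IsPoissonBinomial q) :
    ∃ Q : ℝ[X], (∀ m, 0 ≤ Q.coeff m) ∧
      X * derivative q - C ((derivative q).eval 1) * q = (X - 1) * Q ∧
      ∀ m, 0 ≤ ((1 + X) * Q - C (pgfVariance q) * q).coeff m := by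
  suffices h : q.eval 1 = 1 ∧ (∀ m, 0 ≤ q.coeff m) ∧ ∃ Q : ℝ[X], (∀ m, 0 ≤ Q.coeff m) ∧
      X * derivative q - C ((derivative q).eval 1) * q = (X - 1) * Q ∧
      ∀ m, 0 ≤ ((1 + X) * Q - C (pgfVariance q) * q).coeff m from h.2.2
  refine hq.induction ?_ ?_
  · refine ⟨by simp, fun m => ?_, 0, by simp, by simp, by simp [pgfVariance]⟩
    rw [coeff_one]; split_ifs <;> norm_num
  · rintro r q h0 h1 ⟨he, hc, Q, hQ, hQ1, hQ2⟩
    have hb := coeff_bernoulliPoly_nonneg h0 h1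
    have hr : 0 ≤ r * (1 - r) := mul_nonneg h0 (by linarith)
    have hV : pgfVariance (bernoulliPoly r * q) = pgfVariance q + r * (1 - r) := by
      simp only [pgfVariance, derivative_mul, derivative_bernoulliPoly, derivative_add,
        derivative_C, eval_add, eval_mul, eval_C, eval_one_bernoulliPoly, he, eval_zero]
      ring
    refine ⟨by rw [eval_mul, eval_one_bernoulliPoly, he, one_mul], coeff_mul_nonneg hb hc,
      C (r * (1 - r)) * q + bernoulliPoly r * Q, fun m => ?_, ?_, fun m => ?_⟩
    · rw [coeff_add, coeff_C_mul]
      exact add_nonneg (mul_nonneg hr (hc m)) (coeff_mul_nonneg hb hQ m)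
    · simp only [derivative_mul, derivative_bernoulliPoly, eval_add, eval_mul, eval_C,
        eval_one_bernoulliPoly, he, one_mul, mul_one, C_add, C_mul, C_sub, C_1]
      have : X * derivative q = (X - 1) * Q + C ((derivative q).eval 1) * q := by
        rw [← hQ1]; ring
      rw [show X * (C r * q + bernoulliPoly r * derivative q) =
        X * C r * q + bernoulliPoly r * (X * derivative q) by ring, this]
      simp only [bernoulliPoly, C_sub, C_1]
      ring
    · have e : (1 + X) * (C (r * (1 - r)) * q + bernoulliPoly r * Q)
          - C (pgfVariance (bernoulliPoly r * q)) * (bernoulliPoly r * q) =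
          bernoulliPoly r * ((1 + X) * Q - C (pgfVariance q) * q)
          + C (r * (1 - r)) * (bernoulliPoly (1 - r) * q) := by
        rw [hV]
        simp only [bernoulliPoly, C_sub, C_1, C_add, C_mul]
        ring
      rw [e, coeff_add, coeff_C_mul]
      exact add_nonneg (coeff_mul_nonneg hb hQ2 m) (mul_nonneg hr
        (coeff_mul_nonneg (coeff_bernoulliPoly_nonneg (by linarith) (by linarith)) hc m))

theorem pairing_sq_sub_mean {q : ℝ[X]} (hq : q.eval 1 = 1) :
    pairing (fun j => ((j : ℝ) - (derivative q).eval 1) ^ 2) q = pgfVariance q := by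
  set μ := (derivative q).eval 1 with hμ
  have h1 : pairing (fun j => (j : ℝ) * 1) q = μ := by
    rw [pairing_cast_mul, pairing_const]; simp [hμ]
  have h2 : pairing (fun j => (j : ℝ) * ((j : ℝ) * 1)) q =
      (derivative (derivative q)).eval 1 + μ := by
    rw [pairing_cast_mul, pairing_cast_mul, pairing_const]
    simp [hμ]
    ring
  have h3 : pairing (fun _ => μ ^ 2) q = μ ^ 2 := by rw [pairing_const, hq, mul_one]
  have e : (fun j : ℕ => ((j : ℝ) - μ) ^ 2) =
      fun j : ℕ => ((j : ℝ) * ((j : ℝ) * 1) - (2 * μ) * ((j : ℝ) * 1)) + μ ^ 2 := by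
    funext j; ring
  rw [e, pairing_add_fun, pairing_sub_fun, pairing_const_mul_fun, h1, h2, h3, pgfVariance]
  ring

/-- The zero-bias inequality gives σ² q_m ≤ Q_m + Q_{m-1}, and each Q_m is at most E|W-μ|/2 ≤ σ/2.
-/
theorem IsPoissonBinomial.coeff_le {q : ℝ[X]} (hq : IsPoissonBinomial q) (hV : 0 < pgfVariance q)
    (m : ℕ) : q.coeff m ≤ 1 / √(pgfVariance q) := by
  obtain ⟨Q, hQ, hQ1, hQ2⟩ := hq.exists_zeroBias
  set μ := (derivative q).eval 1 with hμ
  set σ := √(pgfVariance q) with hσ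
  have hσ0 : 0 < σ := Real.sqrt_pos.mpr hV
  have hσ2 : σ * σ = pgfVariance q := Real.mul_self_sqrt hV.le
  have bound : ∀ m, Q.coeff m ≤ σ / 2 := by
    intro m
    -- A step function centred at ±1/2 rather than 0 and 1: its increment still picks out Q_m, while
    -- its sup norm gives the factor 1/2.
    let f : ℕ → ℝ := fun j => if m < j then 1 / 2 else - (1 / 2)
    have hf : (fun j => f (j + 1) - f j) = fun j => if j = m then 1 else 0 := by
      funext j
      simp only [f]
      rcases lt_trichotomy j m with h | h | h
      · rw [if_neg (by omega), if_neg (by omega), if_neg (by omega)]; norm_num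
      · rw [if_pos (by omega), if_neg (by omega), if_pos h]; norm_num
      · rw [if_pos (by omega), if_pos (by omega), if_neg (by omega)]; norm_num
    have h1 : pairing f ((X - 1) * Q) = Q.coeff m := by
      rw [pairing_X_sub_one_mul, hf, pairing_single]
    rw [← hQ1, map_sub, pairing_C_mul, ← pairing_cast_mul, ← pairing_const_mul_fun,
      ← pairing_sub_fun] at h1
    rw [← h1]
    refine (pairing_mono (g := fun j : ℕ => 1 / (4 * σ) * ((j : ℝ) - μ) ^ 2 + σ / 4)
      hq.coeff_nonneg fun j => ?_).trans_eq ?_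
    -- The arithmetic-geometric inequality |x|/2 ≤ x²/(4σ) + σ/4 replaces Cauchy-Schwarz; its
    -- expectation at x = W - μ is σ/2.
    · have key : ∀ x : ℝ, x * (1 / 2) ≤ 1 / (4 * σ) * x ^ 2 + σ / 4 := by
        intro x
        have : 1 / (4 * σ) * x ^ 2 + σ / 4 - x * (1 / 2) = (x - σ) ^ 2 / (4 * σ) := by
          field_simp; ring
        have : 0 ≤ (x - σ) ^ 2 / (4 * σ) := by positivity
        linarith
      simp only [f]
      split_ifs
      · have := key (j - μ); linarith
      · have := key (-(j - μ)); rw [neg_sq] at this; linarith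
    · rw [pairing_add_fun, pairing_const_mul_fun, pairing_const, pairing_sq_sub_mean hq.eval_one,
        hq.eval_one, ← hσ2]
      field_simp; ring
  have h3 := hQ2 m
  rw [coeff_sub, add_mul, one_mul, coeff_add, coeff_C_mul] at h3
  have h4 : (X * Q).coeff m ≤ σ / 2 := by
    rcases m with _ | m
    · rw [mul_coeff_zero, coeff_X_zero, zero_mul]; positivity
    · rw [coeff_X_mul]; exact bound m
  have h5 := bound m
  rw [le_div_iff₀ hσ0]
  have h6 : q.coeff m * σ * σ ≤ 1 * σ := by rw [mul_assoc, hσ2]; linarith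
  exact le_of_mul_le_mul_right h6 hσ0

theorem sum_coeff_X_sub_one_mul (q : ℝ[X]) (n : ℕ) :
    ∑ j ∈ Finset.range n, ((X - 1) * q).coeff j = - (X * q).coeff n := by
  induction n with
  | zero => simp
  | succ n ih => rw [Finset.sum_range_succ, ih, sub_mul, one_mul, coeff_sub, coeff_X_mul]; ring

/-- With one sign change, the ℓ¹ norm of the differences telescopes on each side of the change to at
most the mass at the peak, hence to at most 2b in total. -/
theorem abs_pairing_X_sub_one_mul_le {q : ℝ[X]} {b c : ℝ} {f : ℕ → ℝ} (hf : ∀ m, |f m| ≤ c)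
    (hq : ∀ m, 0 ≤ q.coeff m) (hb : ∀ m, q.coeff m ≤ b)
    (hs : ∃ n, (∀ j < n, ((X - 1) * q).coeff j ≤ 0) ∧ ∀ j, n ≤ j → 0 ≤ ((X - 1) * q).coeff j) :
    |pairing f ((X - 1) * q)| ≤ 2 * b * c := by
  obtain ⟨n, h1, h2⟩ := hs
  set d := ((X - 1) * q).natDegree + 1
  rw [pairing_eq_sum f _ (n := n + d) (by omega)]
  have hc : 0 ≤ c := (abs_nonneg _).trans (hf 0)
  have e1 : ∑ j ∈ Finset.range n, |((X - 1) * q).coeff j| = (X * q).coeff n := by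
    rw [Finset.sum_congr rfl fun j hj => abs_of_nonpos (h1 j (Finset.mem_range.mp hj)),
      Finset.sum_neg_distrib, sum_coeff_X_sub_one_mul, neg_neg]
  have e2 : ∑ j ∈ Finset.range d, |((X - 1) * q).coeff (n + j)| =
      (X * q).coeff n - (X * q).coeff (n + d) := by
    rw [Finset.sum_congr rfl fun j _ => abs_of_nonneg (h2 (n + j) (by omega))]
    have := Finset.sum_range_add (fun j => ((X - 1) * q).coeff j) n d
    rw [sum_coeff_X_sub_one_mul, sum_coeff_X_sub_one_mul] at this
    linarith
  have hX : ∀ m, 0 ≤ (X * q).coeff m ∧ (X * q).coeff m ≤ b := by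
    rintro (_ | m)
    · rw [mul_coeff_zero, coeff_X_zero, zero_mul]
      exact ⟨le_rfl, (hq 0).trans (hb 0)⟩
    · rw [coeff_X_mul]; exact ⟨hq m, hb m⟩
  calc |∑ j ∈ Finset.range (n + d), ((X - 1) * q).coeff j * f j|
      ≤ ∑ j ∈ Finset.range (n + d), |((X - 1) * q).coeff j| * c := by
        refine (Finset.abs_sum_le_sum_abs _ _).trans (Finset.sum_le_sum fun j _ => ?_)
        rw [abs_mul]
        exact mul_le_mul_of_nonneg_left (hf j) (abs_nonneg _)
    _ = (2 * (X * q).coeff n - (X * q).coeff (n + d)) * c := by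
        rw [← Finset.sum_mul, Finset.sum_range_add, e1, e2]; ring
    _ ≤ 2 * b * c := by
        refine mul_le_mul_of_nonneg_right ?_ hc
        linarith [(hX n).2, (hX (n + d)).1]

/-- Nonnegative coefficients exclude positive roots, and for x ≤ 0 the factor X - x is 1 - x times
the Bernoulli polynomial of parameter 1/(1-x). -/
theorem isPoissonBinomial_of_splits {q : ℝ[X]} (hs : q.Splits) (hq : ∀ m, 0 ≤ q.coeff m)
    (h1 : q.eval 1 = 1) : IsPoissonBinomial q := by
  have hroots : ∀ x ∈ q.roots, x ≤ 0 := by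
    intro x hx
    by_contra! hx0
    have hr : q.eval x = 0 := (mem_roots'.mp hx).2
    rw [eval_eq_sum_range, Finset.sum_eq_zero_iff_of_nonneg
      fun i _ => mul_nonneg (hq i) (pow_nonneg hx0.le i)] at hr
    have h0 : q.eval 1 = 0 := by
      rw [eval_eq_sum_range]
      refine Finset.sum_eq_zero fun i hi => ?_
      rcases mul_eq_zero.mp (hr i hi) with h | h
      · rw [h, zero_mul]
      · exact absurd h (pow_pos hx0 i).ne'
    linarith
  refine ⟨q.roots.map fun x => (1 - x)⁻¹, fun r hr => ?_, ?_⟩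
  · obtain ⟨x, hx, rfl⟩ := Multiset.mem_map.mp hr
    have := hroots x hx
    exact ⟨inv_nonneg.mpr (by linarith), inv_le_one_of_one_le₀ (by linarith)⟩
  · have e : ∀ s : Multiset ℝ, (∀ x ∈ s, x ≤ 0) → (s.map fun x => X - C x).prod =
        C (s.map fun x => 1 - x).prod * ((s.map fun x => (1 - x)⁻¹).map bernoulliPoly).prod := by
      intro s hs
      induction s using Multiset.induction_on with
      | empty => simp
      | cons x s ih =>
        have hx : (1 : ℝ) - x ≠ 0 := by
          have := hs x (Multiset.mem_cons_self _ _)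
          linarith
        have hb : X - C x = C (1 - x) * bernoulliPoly (1 - x)⁻¹ := by
          rw [bernoulliPoly, mul_add, ← mul_assoc, ← C_mul, ← C_mul, mul_sub,
            mul_inv_cancel₀ hx]
          simp only [C_sub, C_1, mul_one]
          ring
        simp only [Multiset.map_cons, Multiset.prod_cons, C_mul]
        rw [ih fun y hy => hs y (Multiset.mem_cons_of_mem hy), hb]
        ring
    have h2 := hs.eval_eq_prod_roots 1
    rw [h1] at h2
    conv_lhs => rw [hs.eq_prod_roots, e _ hroots, ← mul_assoc, ← C_mul, ← h2, C_1, one_mul]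

/-! ### Real-rootedness of the run polynomials and the smoothing estimate. -/

variable {a : ℝ} {k : ℕ}

/-- With z = a(u-1) in the upper half-plane, the invariant H controls the arguments of the last k
values: each earlier e_i lies between e_N / z and e_N in angle. If e_N = 0, then e_{N-1} = -z
e_{N-k}, and Im(e_{N-1} · conj e_{N-k}) would be negative, against the invariant. -/
theorem aeval_runPoly_ne_zero (ha : 0 < a) (hk : 1 ≤ k) {u : ℂ} (hu : 0 < u.im) (N : ℕ) :
    aeval u (runPoly a k N) ≠ 0 := by
  set z : ℂ := a * (u - 1) with hz
  have hzim : 0 < z.im := by simp [hz]; positivity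
  set e : ℕ → ℂ := fun N => aeval u (runPoly a k N) with he
  have e0 : ∀ N < k, e N = 1 := fun N h => by simp [he, runPoly_of_lt h]
  have e1 : ∀ N, k ≤ N → e N = e (N - 1) + z * e (N - k) := fun N h => by
    simp only [he]
    rw [runPoly_of_le hk h]
    simp [hz]
  suffices H : ∀ N, e N ≠ 0 ∧ ∀ i ≤ N, N < i + k →
      0 ≤ (e N * (starRingEnd ℂ) (e i)).im ∧ 0 ≤ (z * (e i * (starRingEnd ℂ) (e N))).im from
    (H N).1
  have hself : ∀ w : ℂ, 0 ≤ (w * (starRingEnd ℂ) w).im ∧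
      0 ≤ (z * (w * (starRingEnd ℂ) w)).im := by
    intro w
    rw [Complex.mul_conj, Complex.ofReal_im, Complex.im_mul_ofReal]
    exact ⟨le_rfl, mul_nonneg hzim.le (Complex.normSq_nonneg _)⟩
  intro N
  induction N using Nat.strong_induction_on with
  | _ N ih =>
    rcases lt_or_ge N k with h | h
    · rw [e0 N h]
      refine ⟨one_ne_zero, fun i hi _ => ?_⟩
      rw [e0 i (by omega)]
      simpa using hzim.le
    · have hne := (ih (N - k) (by omega)).1
      have hI := ((ih (N - 1) (by omega)).2 (N - k) (by omega) (by omega)).1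
      refine ⟨fun h0 => ?_, fun i hi hik => ?_⟩
      · rw [e1 N h, add_eq_zero_iff_eq_neg] at h0
        rw [h0, neg_mul, mul_assoc, Complex.mul_conj, Complex.neg_im, Complex.im_mul_ofReal] at hI
        have := mul_pos hzim (Complex.normSq_pos.mpr hne)
        linarith
      · rcases hi.eq_or_lt with rfl | hi
        · exact hself _
        · have hA := (ih (N - 1) (by omega)).2 i (by omega) (by omega)
          have hB := (ih i (by omega)).2 (N - k) (by omega) (by omega)
          rw [e1 N h]
          constructor
          · rw [add_mul, Complex.add_im, mul_assoc]
            exact add_nonneg hA.1 hB.2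
          · rw [map_add, map_mul, mul_add, mul_add, Complex.add_im]
            refine add_nonneg hA.2 ?_
            rw [show z * (e i * ((starRingEnd ℂ) z * (starRingEnd ℂ) (e (N - k)))) =
              (e i * (starRingEnd ℂ) (e (N - k))) * (z * (starRingEnd ℂ) z) by ring,
              Complex.mul_conj, Complex.im_mul_ofReal]
            exact mul_nonneg hB.1 (Complex.normSq_nonneg _)

theorem splits_runPoly (ha : 0 < a) (hk : 1 ≤ k) (N : ℕ) : (runPoly a k N).Splits := by
  refine Splits.of_splits_map (algebraMap ℝ ℂ) (IsAlgClosed.splits _) fun x hx => ?_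
  have hroot : aeval x (runPoly a k N) = 0 := by
    have := (mem_roots'.mp hx).2
    rwa [IsRoot.def, eval_map_algebraMap] at this
  have him : x.im = 0 := by
    rcases lt_trichotomy x.im 0 with h | h | h
    · refine absurd ?_ (aeval_runPoly_ne_zero (u := (starRingEnd ℂ) x) ha hk
        (by simpa using h) N)
      rw [← Complex.conjAe_coe, aeval_algHom_apply, hroot, map_zero]
    · exact h
    · exact absurd hroot (aeval_runPoly_ne_zero ha hk h N)
  exact ⟨x.re, Complex.ext (by simp) (by simp [him])⟩

theorem le_pgfVariance_runPoly (hk : 1 ≤ k) {N : ℕ} (hN : k ≤ N + 1) :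
    a * (N + 1 - k : ℕ) * (1 - (2 * k - 1) * a) ≤ pgfVariance (runPoly a k N) := by
  have := le_eval_one_derivative_two_runPoly (a := a) hk hN
  rw [pgfVariance, eval_one_derivative_runPoly hk]
  linarith

theorem abs_pairing_X_sub_one_mul_runPoly_le (ha : 0 < a) (hk : 1 ≤ k)
    (hka : (2 * k - 1) * a ≤ 8 / 9) {N : ℕ} (hN : k ≤ N)
    (hnn : ∀ m, 0 ≤ (runPoly a k N).coeff m) {f : ℕ → ℝ} {c : ℝ} (hf : ∀ m, |f m| ≤ c) :
    |pairing f ((X - 1) * runPoly a k N)| ≤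
      2 * c * min 1 (3 / √((N + 1 - k : ℕ) * a)) := by
  have hpb := isPoissonBinomial_of_splits (splits_runPoly ha hk N) hnn (eval_one_runPoly hk N)
  have hc : 0 ≤ c := (abs_nonneg _).trans (hf 0)
  have hs : (0 : ℝ) < (N + 1 - k : ℕ) := by exact_mod_cast (show 0 < N + 1 - k by omega)
  have hV := le_pgfVariance_runPoly (a := a) hk (N := N) (by omega)
  set s : ℝ := ((N + 1 - k : ℕ) : ℝ)
  have hsa : 0 < s * a := mul_pos hs ha
  -- The bound (2k-1)a ≤ 8/9 leaves at least a ninth of the Poisson-type variance; its square root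
  -- is the source of the 3.
  have hV' : s * a / 9 ≤ pgfVariance (runPoly a k N) := by nlinarith
  have hV0 : 0 < pgfVariance (runPoly a k N) := by linarith
  have hb : ∀ m, (runPoly a k N).coeff m ≤ min 1 (3 / √(s * a)) := by
    intro m
    refine le_min ?_ ((hpb.coeff_le hV0 m).trans ?_)
    · have h1 := pairing_mono (f := fun j => if j = m then 1 else 0) (g := fun _ => 1) hnn
        (fun j => by split_ifs <;> norm_num)
      rwa [pairing_single, pairing_const, eval_one_runPoly hk, mul_one] at h1
    · have h3 : √(s * a) / 3 ≤ √(pgfVariance (runPoly a k N)) := by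
        rw [show √(s * a) / 3 = √(s * a / 9) by
          rw [Real.sqrt_div' _ (by norm_num), show (9 : ℝ) = 3 ^ 2 by norm_num,
            Real.sqrt_sq (by norm_num)]]
        exact Real.sqrt_le_sqrt hV'
      have h4 : 0 < √(s * a) := Real.sqrt_pos.mpr hsa
      rw [div_le_div_iff₀ (by linarith) h4]
      linarith
  refine (abs_pairing_X_sub_one_mul_le hf hnn hb hpb.sign_change).trans_eq (by ring)

end Smoothing

/-! ### Stein equation of a birth-death chain. -/

section SteinEquation

/-- A, s, B are the parts of the mean of the test function below, at and above a state; F, π, G are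
the corresponding full masses. The increment is linear in A, s, B with fixed signs, so its extremes
come from the corners of the box and give |T| ≤ π(dG + cF), where dG + cF is at most both c and d.
-/
theorem stein_increment_bound {A B s F G π c d : ℝ} (hA : 0 ≤ A) (hAF : A ≤ F) (hB : 0 ≤ B)
    (hBG : B ≤ G) (hs : 0 ≤ s) (hsπ : s ≤ π) (hsum : F + π + G = 1) (hπ : 0 < π) (hc : 0 < c)
    (hd : 0 < d) (h1 : c * F ≤ d * (F + π)) (h2 : d * G ≤ c * (G + π)) :
    |(A + s - (A + s + B) * (F + π)) / (c * π) - (A - (A + s + B) * F) / (d * π)| ≤ 1 / c ∧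
    |(A + s - (A + s + B) * (F + π)) / (c * π) - (A - (A + s + B) * F) / (d * π)| ≤ 1 / d := by
  set T := d * (A + s - (A + s + B) * (F + π)) - c * (A - (A + s + B) * F) with hT
  have e : (A + s - (A + s + B) * (F + π)) / (c * π) - (A - (A + s + B) * F) / (d * π) =
      T / (c * d * π) := by
    rw [hT]; field_simp
  have hG : G = 1 - F - π := by linarith
  have eT : T = A * (d * G - c * (G + π)) + s * (d * G + c * F) - B * (d * (F + π) - c * F) := by
    rw [hT, hG]; ring
  have hF0 : 0 ≤ F := hA.trans hAF
  have hG0 : 0 ≤ G := hB.trans hBG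
  have hW : 0 ≤ d * G + c * F := by positivity
  have t1 : A * (c * (G + π) - d * G) ≤ F * (c * (G + π) - d * G) :=
    mul_le_mul_of_nonneg_right hAF (by linarith)
  have t2 : B * (d * (F + π) - c * F) ≤ G * (d * (F + π) - c * F) :=
    mul_le_mul_of_nonneg_right hBG (by linarith)
  have t3 : s * (d * G + c * F) ≤ π * (d * G + c * F) := mul_le_mul_of_nonneg_right hsπ hW
  have t4 : 0 ≤ s * (d * G + c * F) := mul_nonneg hs hW
  have t5 : 0 ≤ A * (c * (G + π) - d * G) := mul_nonneg hA (by linarith)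
  have t6 : 0 ≤ B * (d * (F + π) - c * F) := mul_nonneg hB (by linarith)
  have hTabs : |T| ≤ π * (d * G + c * F) := by
    rw [abs_le]
    constructor
    · rw [eT]; linarith
    · rw [eT]; linarith
  have w1 : d * G + c * F ≤ d := by
    calc d * G + c * F ≤ d * G + d * (F + π) := by linarith
      _ = d * (F + π + G) := by ring
      _ = d := by rw [hsum, mul_one]
  have w2 : d * G + c * F ≤ c := by
    calc d * G + c * F ≤ c * (G + π) + c * F := by linarith
      _ = c * (F + π + G) := by ring
      _ = c := by rw [hsum, mul_one]
  have hpos : 0 < c * d * π := by positivity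
  rw [e, abs_div, abs_of_pos hpos]
  constructor
  · rw [div_le_div_iff₀ hpos hc]
    have := mul_le_mul_of_nonneg_left w1 (mul_nonneg hπ.le hc.le)
    have := mul_le_mul_of_nonneg_right hTabs hc.le
    linarith
  · rw [div_le_div_iff₀ hpos hd]
    have := mul_le_mul_of_nonneg_left w2 (mul_nonneg hπ.le hd.le)
    have := mul_le_mul_of_nonneg_right hTabs hd.le
    linarith

/-- The Stein equation of a birth-death chain on `{0, …, K}` with birth rates `c`, death rates `d`
and stationary law `π`. -/
theorem exists_birthDeath_stein_solution {K : ℕ} {π c d : ℕ → ℝ} (hK : 1 ≤ K)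
    (hπ : ∀ m ≤ K, 0 < π m) (hsum : ∑ m ∈ Finset.range (K + 1), π m = 1)
    (hbal : ∀ m < K, d (m + 1) * π (m + 1) = c m * π m)
    (hc : Antitone c) (hcpos : ∀ m < K, 0 < c m) (hd : Monotone d) (hd0 : d 0 = 0)
    (hdpos : ∀ m, 0 < m → 0 < d m)
    {h : ℕ → ℝ} (h0 : ∀ m, 0 ≤ h m) (h1 : ∀ m, h m ≤ 1) :
    ∃ g : ℕ → ℝ, (∀ m ≤ K, c m * g (m + 1) - d m * g m =
        h m - ∑ j ∈ Finset.range (K + 1), h j * π j) ∧ (∀ m, K < m → g m = 0) ∧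
      (∀ m, 1 ≤ m → m < K → |g (m + 1) - g m| ≤ 1 / c m ∧ |g (m + 1) - g m| ≤ 1 / d m) ∧
      |g K| ≤ 1 / d K := by
  set w := ∑ j ∈ Finset.range (K + 1), h j * π j with hw
  set H : ℕ → ℝ := fun m => ∑ j ∈ Finset.range m, h j * π j - w * ∑ j ∈ Finset.range m, π j with hH
  have hHs : ∀ m, H (m + 1) = H m + (h m - w) * π m := by
    intro m
    simp only [hH, Finset.sum_range_succ]
    ring
  have hHK : H (K + 1) = 0 := by simp only [hH]; rw [hsum, ← hw]; ring
  have hw0 : 0 ≤ w := Finset.sum_nonneg fun j hj => mul_nonneg (h0 j)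
    (hπ j (by rw [Finset.mem_range] at hj; omega)).le
  have hw1 : w ≤ 1 := by
    rw [← hsum]
    refine Finset.sum_le_sum fun j hj => ?_
    exact mul_le_of_le_one_left (hπ j (by rw [Finset.mem_range] at hj; omega)).le (h1 j)
  set g : ℕ → ℝ := fun m => if m ≤ K then H m / (d m * π m) else 0 with hg
  have hgK : g (K + 1) = 0 := by simp [hg]
  have heq : ∀ m ≤ K, c m * g (m + 1) - d m * g m = h m - w := by
    intro m hm
    have hπm := hπ m hm
    have e1 : c m * g (m + 1) = H (m + 1) / π m := by
      rcases hm.eq_or_lt with rfl | hlt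
      · rw [hgK, hHK]; simp
      · have hcm := hcpos m hlt
        simp only [hg]
        rw [if_pos (by omega), hbal m hlt]
        field_simp
    have e2 : d m * g m = H m / π m := by
      rcases Nat.eq_zero_or_pos m with rfl | hpos
      · rw [hd0]; simp [hH]
      · have := hdpos m hpos
        simp only [hg]
        rw [if_pos hm]
        field_simp
    rw [e1, e2, hHs]
    field_simp
    ring
  refine ⟨g, heq, fun m hm => by simp [hg, hm], fun m hm1 hmK => ?_, ?_⟩
  · have hπm := hπ m hmK.le
    have hcm := hcpos m hmK
    have hdm := hdpos m hm1
    obtain ⟨r, hr⟩ : ∃ r, K + 1 = m + 1 + r := ⟨K - m, by omega⟩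
    set F := ∑ j ∈ Finset.range m, π j with hF
    set G := ∑ j ∈ Finset.range r, π (m + 1 + j) with hG
    set A := ∑ j ∈ Finset.range m, h j * π j with hA
    set B := ∑ j ∈ Finset.range r, h (m + 1 + j) * π (m + 1 + j) with hB
    have hπn : ∀ j, j < m + 1 + r → 0 < π j := fun j hj => hπ j (by omega)
    have hsumFG : F + π m + G = 1 := by
      rw [← hsum, hr, Finset.sum_range_add, Finset.sum_range_succ]
    have hwAB : w = A + h m * π m + B := by
      rw [hw, hr, Finset.sum_range_add, Finset.sum_range_succ]
    have e : g (m + 1) - g m = (A + h m * π m - (A + h m * π m + B) * (F + π m)) / (c m * π m)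
        - (A - (A + h m * π m + B) * F) / (d m * π m) := by
      simp only [hg]
      rw [if_pos (by omega), if_pos hmK.le, hbal m hmK]
      simp only [hH]
      rw [Finset.sum_range_succ, Finset.sum_range_succ, hwAB]
    rw [e]
    refine stein_increment_bound
      (Finset.sum_nonneg fun j hj => mul_nonneg (h0 j)
        (hπn j (by rw [Finset.mem_range] at hj; omega)).le)
      (Finset.sum_le_sum fun j hj => mul_le_of_le_one_left
        (hπn j (by rw [Finset.mem_range] at hj; omega)).le (h1 j))
      (Finset.sum_nonneg fun j hj => mul_nonneg (h0 _)
        (hπn _ (by rw [Finset.mem_range] at hj; omega)).le)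
      (Finset.sum_le_sum fun j hj => mul_le_of_le_one_left
        (hπn _ (by rw [Finset.mem_range] at hj; omega)).le (h1 _))
      (mul_nonneg (h0 m) hπm.le) (mul_le_of_le_one_left hπm.le (h1 m)) hsumFG hπm hcm hdm ?_ ?_
    -- Detailed balance moves each mass one state up; monotone rates allow c and d to be frozen at
    -- m.
    · calc c m * F = ∑ j ∈ Finset.range m, c m * π j := by rw [hF, Finset.mul_sum]
        _ ≤ ∑ j ∈ Finset.range m, d m * π (j + 1) := by
          refine Finset.sum_le_sum fun j hj => ?_
          rw [Finset.mem_range] at hj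
          calc c m * π j ≤ c j * π j :=
                mul_le_mul_of_nonneg_right (hc hj.le) (hπn j (by omega)).le
            _ = d (j + 1) * π (j + 1) := (hbal j (by omega)).symm
            _ ≤ d m * π (j + 1) :=
                mul_le_mul_of_nonneg_right (hd (by omega)) (hπn _ (by omega)).le
        _ = d m * ∑ j ∈ Finset.range m, π (j + 1) := by rw [Finset.mul_sum]
        _ ≤ d m * (F + π m) := by
          refine mul_le_mul_of_nonneg_left ?_ hdm.le
          rw [hF, ← Finset.sum_range_succ, Finset.sum_range_succ']
          linarith [hπn 0 (by omega)]
    · calc d m * G = ∑ j ∈ Finset.range r, d m * π (m + 1 + j) := by rw [hG, Finset.mul_sum]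
        _ ≤ ∑ j ∈ Finset.range r, c m * π (m + j) := by
          refine Finset.sum_le_sum fun j hj => ?_
          rw [Finset.mem_range] at hj
          calc d m * π (m + 1 + j) ≤ d (m + 1 + j) * π (m + 1 + j) :=
                mul_le_mul_of_nonneg_right (hd (by omega)) (hπn _ (by omega)).le
            _ = c (m + j) * π (m + j) := by
                rw [show m + 1 + j = m + j + 1 by omega]; exact hbal _ (by omega)
            _ ≤ c m * π (m + j) :=
                mul_le_mul_of_nonneg_right (hc (by omega)) (hπn _ (by omega)).le
        _ = c m * ∑ j ∈ Finset.range r, π (m + j) := by rw [Finset.mul_sum]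
        _ ≤ c m * (G + π m) := by
          refine mul_le_mul_of_nonneg_left ?_ hcm.le
          have h2 : ∑ j ∈ Finset.range (r + 1), π (m + j) = G + π m := by
            rw [Finset.sum_range_succ', hG, add_zero]
            congr 1
            exact Finset.sum_congr rfl fun j _ => by rw [show m + (j + 1) = m + 1 + j by omega]
          rw [← h2, Finset.sum_range_succ]
          linarith [hπn (m + r) (by omega)]
  · have hdK := hdpos K hK
    have h2 := heq K le_rfl
    rw [hgK, mul_zero, zero_sub] at h2
    have h3 : |d K * g K| ≤ 1 := by
      rw [← abs_neg, h2, abs_le]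
      constructor <;> linarith [h0 K, h1 K]
    rw [abs_mul, abs_of_pos hdK] at h3
    rw [le_div_iff₀ hdK]
    linarith

/-! ### The pseudo-binomial law as a stationary law. -/

theorem pseudoBinomialWeight_succ {α r : ℝ} (hr : r < 1) (m : ℕ) :
    ((m + 1 : ℕ) * (1 - r)) * pseudoBinomialWeight α r (m + 1) =
      ((α - m) * r) * pseudoBinomialWeight α r m := by
  have h := Ring.choose_smul_choose α (Nat.le_succ m)
  rw [Nat.choose_succ_self_right, Nat.succ_sub (le_refl m), Nat.sub_self, nsmul_eq_mul,
    Nat.succ_eq_add_one] at h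
  rw [show Nat.succ 0 = 1 from rfl, Ring.choose_one_right] at h
  have h2 : (1 - r) ^ (α - (m : ℝ)) = (1 - r) ^ (α - ((m + 1 : ℕ) : ℝ)) * (1 - r) := by
    conv_rhs => rw [← Real.rpow_one (1 - r), ← Real.rpow_mul (by linarith)]
    rw [one_mul, ← Real.rpow_add (by linarith)]
    congr 1
    push_cast; ring
  rw [pseudoBinomialWeight, pseudoBinomialWeight, h2, pow_succ]
  calc _ = (((m + 1 : ℕ) : ℝ) * Ring.choose α (m + 1)) *
        (r ^ m * r * ((1 - r) ^ (α - ((m + 1 : ℕ) : ℝ)) * (1 - r))) := by ring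
    _ = _ := by rw [h]; ring

theorem pseudoBinomialWeight_pos {α r : ℝ} (hα : 0 < α) (hr0 : 0 < r) (hr : r < 1) {m : ℕ}
    (hm : m ≤ ⌊α⌋₊) : 0 < pseudoBinomialWeight α r m := by
  induction m with
  | zero =>
    rw [pseudoBinomialWeight, Ring.choose_zero_right]
    have : 0 < (1 - r) ^ (α - ((0 : ℕ) : ℝ)) := Real.rpow_pos_of_pos (by linarith) _
    simpa using this
  | succ m ih =>
    have h := pseudoBinomialWeight_succ (α := α) hr m
    have hmα : ((m + 1 : ℕ) : ℝ) ≤ α := (Nat.le_floor_iff hα.le).mp hm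
    push_cast at hmα
    have h2 : 0 < ((α - m) * r) * pseudoBinomialWeight α r m :=
      mul_pos (mul_pos (by linarith) hr0) (ih (by omega))
    rw [← h] at h2
    refine pos_of_mul_pos_right h2 (mul_nonneg (Nat.cast_nonneg _) (by linarith))

theorem pseudoBinomialPMF_pos {α r : ℝ} (hα : 0 < α) (hr0 : 0 < r) (hr : r < 1) {m : ℕ}
    (hm : m ≤ ⌊α⌋₊) : 0 < pseudoBinomialPMF α r m := by
  rw [pseudoBinomialPMF, if_pos hm]
  refine div_pos (pseudoBinomialWeight_pos hα hr0 hr hm) (Finset.sum_pos (fun j hj =>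
    pseudoBinomialWeight_pos hα hr0 hr ?_) ⟨0, Finset.mem_range.mpr (Nat.succ_pos _)⟩)
  rw [Finset.mem_range] at hj
  omega

theorem sum_pseudoBinomialPMF {α r : ℝ} (hα : 0 < α) (hr0 : 0 < r) (hr : r < 1) :
    ∑ j ∈ Finset.range (⌊α⌋₊ + 1), pseudoBinomialPMF α r j = 1 := by
  have hpos : 0 < ∑ j ∈ Finset.range (⌊α⌋₊ + 1), pseudoBinomialWeight α r j :=
    Finset.sum_pos (fun j hj => pseudoBinomialWeight_pos hα hr0 hr
      (by rw [Finset.mem_range] at hj; omega)) ⟨0, Finset.mem_range.mpr (Nat.succ_pos _)⟩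
  rw [← div_self hpos.ne', Finset.sum_div]
  refine Finset.sum_congr rfl fun j hj => ?_
  rw [pseudoBinomialPMF, if_pos (by rw [Finset.mem_range] at hj; omega)]

theorem exists_pseudoBinomial_stein_solution {α r : ℝ} (hα : 0 < α) (hr0 : 0 < r) (hr : r < 1)
    (hK : 1 ≤ ⌊α⌋₊) {h : ℕ → ℝ} (h0 : ∀ m, 0 ≤ h m) (h1 : ∀ m, h m ≤ 1) :
    ∃ g : ℕ → ℝ, (∀ m ≤ ⌊α⌋₊, (α - m) * r * g (m + 1) - m * (1 - r) * g m =
        h m - ∑ j ∈ Finset.range (⌊α⌋₊ + 1), h j * pseudoBinomialPMF α r j) ∧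
      (∀ m, ⌊α⌋₊ < m → g m = 0) ∧
      ∀ m, |g (m + 2) - g (m + 1)| ≤ 1 / (⌊α⌋₊ * r * (1 - r)) := by
  set K := ⌊α⌋₊ with hKdef
  have hKα : (K : ℝ) ≤ α := Nat.floor_le hα.le
  have hK0 : (0 : ℝ) < K := by exact_mod_cast hK
  have hq : 0 < 1 - r := by linarith
  have hpmf : ∀ m ≤ K, pseudoBinomialPMF α r m = pseudoBinomialWeight α r m /
      ∑ j ∈ Finset.range (K + 1), pseudoBinomialWeight α r j := fun m hm => by
    rw [pseudoBinomialPMF, if_pos hm]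
  obtain ⟨g, hg1, hg2, hg3, hg4⟩ := exists_birthDeath_stein_solution (K := K)
    (π := pseudoBinomialPMF α r) (c := fun m => (α - m) * r) (d := fun m => m * (1 - r)) hK
    (fun m hm => pseudoBinomialPMF_pos hα hr0 hr hm) (sum_pseudoBinomialPMF hα hr0 hr)
    (fun m hm => by
      rw [hpmf m hm.le, hpmf (m + 1) hm, ← mul_div_assoc, ← mul_div_assoc,
        pseudoBinomialWeight_succ hr])
    (fun i j hij => mul_le_mul_of_nonneg_right
      (by have : (i : ℝ) ≤ j := by exact_mod_cast hij
          linarith) hr0.le)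
    (fun m hm => mul_pos (by
      have : (m : ℝ) < K := by exact_mod_cast hm
      linarith) hr0)
    (fun i j hij => mul_le_mul_of_nonneg_right (by exact_mod_cast hij) hq.le)
    (by simp) (fun m hm => mul_pos (by exact_mod_cast hm) hq) h0 h1
  refine ⟨g, hg1, hg2, fun m => ?_⟩
  have hpos : 0 < K * r * (1 - r) := by positivity
  rcases lt_trichotomy (m + 1) K with hm | hm | hm
  · obtain ⟨b1, b2⟩ := hg3 (m + 1) (by omega) hm
    have hmK : ((m + 1 : ℕ) : ℝ) < K := by exact_mod_cast hm
    -- The average of birth and death rates with weights 1 - r and r is αr(1-r), so the larger rate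
    -- is at least that.
    have e : (1 - r) * ((α - (m + 1 : ℕ)) * r) + r * ((m + 1 : ℕ) * (1 - r)) = α * r * (1 - r) := by
      ring
    have hle : K * r * (1 - r) ≤ α * r * (1 - r) := by gcongr
    rcases le_total ((α - (m + 1 : ℕ)) * r) ((m + 1 : ℕ) * (1 - r)) with hcd | hcd
    · refine b2.trans (one_div_le_one_div_of_le hpos ?_)
      have := mul_le_mul_of_nonneg_left hcd hq.le
      linarith
    · refine b1.trans (one_div_le_one_div_of_le hpos ?_)
      have := mul_le_mul_of_nonneg_left hcd hr0.le
      linarith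
  -- At the top state only the death rate ⌊α⌋(1-r) is available, so here the bound has ⌊α⌋ instead
  -- of α.
  · rw [hg2 (m + 2) (by omega), hm, zero_sub, abs_neg]
    refine hg4.trans (one_div_le_one_div_of_le hpos ?_)
    exact mul_le_mul_of_nonneg_right (mul_le_of_le_one_right hK0.le hr.le) hq.le
  · rw [hg2 (m + 2) (by omega), hg2 (m + 1) (by omega), sub_zero, abs_zero]
    positivity

end SteinEquation

/-! ### Laws of the run counts for Bernoulli trials. -/

section RunLaws
open Polynomial

variable {k₁ k₂ : ℕ}

theorem runIndicator_congr {x x' : ℕ → ℕ} {l : ℕ}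
    (h : ∀ i < k₁ + k₂, x (l + i) = x' (l + i)) :
    runIndicator k₁ k₂ x l = runIndicator k₁ k₂ x' l := by
  rw [runIndicator, runIndicator]
  congr 1
  · refine Finset.prod_congr rfl fun i hi => ?_
    rw [Finset.mem_range] at hi
    rw [h i (by omega)]
  · refine Finset.prod_congr rfl fun i hi => ?_
    rw [Finset.mem_range] at hi
    rw [add_assoc, h (k₁ + i) (by omega)]

theorem runIndicator_le_one {x : ℕ → ℕ} (hx : ∀ j, x j ≤ 1) (l : ℕ) :
    runIndicator k₁ k₂ x l ≤ 1 := by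
  rw [runIndicator]
  refine mul_le_one' (Finset.prod_le_one' fun i _ => ?_) (Finset.prod_le_one' fun i _ => hx _)
  omega

theorem runIndicator_eq_zero_of_overlap (hk : (1 ≤ k₁ ∧ 1 ≤ k₂) ∨ k₁ + k₂ = 1) {x : ℕ → ℕ}
    {l l' : ℕ} (h1 : l < l') (h2 : l' < l + (k₁ + k₂))
    (hl : runIndicator k₁ k₂ x l ≠ 0) : runIndicator k₁ k₂ x l' = 0 := by
  by_contra hl'
  have key : ∀ {l}, runIndicator k₁ k₂ x l ≠ 0 →
      (∀ i < k₁, x (l + i) = 0) ∧ ∀ i < k₂, x (l + k₁ + i) ≠ 0 := by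
    intro l h
    rw [runIndicator, mul_ne_zero_iff, Finset.prod_ne_zero_iff, Finset.prod_ne_zero_iff] at h
    refine ⟨fun i hi => ?_, fun i hi => h.2 i (Finset.mem_range.mpr hi)⟩
    have := h.1 i (Finset.mem_range.mpr hi)
    omega
  obtain ⟨a0, a1⟩ := key hl
  obtain ⟨b0, b1⟩ := key hl'
  rcases le_total (l' - l) k₂ with h | h
  · have h3 := b0 (k₁ - 1) (by omega)
    have h4 := a1 (l' - l - 1) (by omega)
    rw [show l + k₁ + (l' - l - 1) = l' + (k₁ - 1) by omega] at h4
    exact h4 h3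
  · have h3 := a1 (k₂ - 1) (by omega)
    have h4 := b0 (l + k₁ + (k₂ - 1) - l') (by omega)
    rw [show l' + (l + k₁ + (k₂ - 1) - l') = l + k₁ + (k₂ - 1) by omega] at h4
    exact h3 h4

/-- The number of `(k₁, k₂)`-runs among the trials `x (s + 1), …, x (s + N)`. -/
def shiftedRunCount (k₁ k₂ : ℕ) (x : ℕ → ℕ) (s N : ℕ) : ℕ :=
  ∑ i ∈ Finset.range (N + 1 - (k₁ + k₂)), runIndicator k₁ k₂ x (s + 1 + i)

theorem shiftedRunCount_congr {x x' : ℕ → ℕ} {s N : ℕ}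
    (h : ∀ i < N, x (s + 1 + i) = x' (s + 1 + i)) :
    shiftedRunCount k₁ k₂ x s N = shiftedRunCount k₁ k₂ x' s N := by
  refine Finset.sum_congr rfl fun i hi => runIndicator_congr fun j hj => ?_
  rw [Finset.mem_range] at hi
  rw [add_assoc _ i j, h (i + j) (by omega)]

theorem shiftedRunCount_le {x : ℕ → ℕ} (hx : ∀ j, x j ≤ 1) (s N : ℕ) :
    shiftedRunCount k₁ k₂ x s N ≤ N + 1 := by
  refine (Finset.sum_le_sum fun i _ => runIndicator_le_one hx _).trans ?_
  simp

/-- A run ending at trial N excludes all others meeting the last k trials, so the count before it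
depends only on the first N - k trials, which are independent of that run. This is the pathwise form
of the recurrence for L_N. -/
theorem apply_shiftedRunCount (hk : (1 ≤ k₁ ∧ 1 ≤ k₂) ∨ k₁ + k₂ = 1) {x : ℕ → ℕ}
    (hx : ∀ j, x j ≤ 1) (s : ℕ) {N : ℕ} (hN : k₁ + k₂ ≤ N) (f : ℕ → ℝ) :
    f (shiftedRunCount k₁ k₂ x s N) = f (shiftedRunCount k₁ k₂ x s (N - 1)) +
      runIndicator k₁ k₂ x (s + 1 + (N - (k₁ + k₂))) *
        (f (shiftedRunCount k₁ k₂ x s (N - (k₁ + k₂)) + 1) -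
          f (shiftedRunCount k₁ k₂ x s (N - (k₁ + k₂)))) := by
  set k := k₁ + k₂ with hkdef
  have e : shiftedRunCount k₁ k₂ x s N = shiftedRunCount k₁ k₂ x s (N - 1) +
      runIndicator k₁ k₂ x (s + 1 + (N - k)) := by
    rw [shiftedRunCount, shiftedRunCount, ← hkdef, show N + 1 - k = N - k + 1 by omega,
      Finset.sum_range_succ, show N - 1 + 1 - k = N - k by omega]
  have hle := runIndicator_le_one (k₁ := k₁) (k₂ := k₂) hx (s + 1 + (N - k))
  rcases Nat.eq_zero_or_pos (runIndicator k₁ k₂ x (s + 1 + (N - k))) with h0 | h0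
  · rw [e, h0]; simp
  · have h1 : runIndicator k₁ k₂ x (s + 1 + (N - k)) = 1 := by omega
    have e2 : shiftedRunCount k₁ k₂ x s (N - 1) = shiftedRunCount k₁ k₂ x s (N - k) := by
      symm
      refine Finset.sum_subset (Finset.range_mono (by omega)) fun i hi hi' => ?_
      rw [Finset.mem_range] at hi hi'
      by_contra hne
      have := runIndicator_eq_zero_of_overlap hk (l' := s + 1 + (N - k)) (by omega) (by omega) hne
      omega
    rw [e, h1, e2]; simp

/-- At most one of the k - 1 wrapping positions carries a run, and when one does, every other run
lies in the complementary arc of n - k trials. -/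
theorem apply_cyclic_sum (hk : (1 ≤ k₁ ∧ 1 ≤ k₂) ∨ k₁ + k₂ = 1) {x : ℕ → ℕ}
    (hx : ∀ j, x j ≤ 1) {n : ℕ} (hn : 2 * (k₁ + k₂) ≤ n) (hper : ∀ j, x (j + 1 + n) = x (j + 1))
    (f : ℕ → ℝ) :
    f (∑ l ∈ Finset.Icc 1 n, runIndicator k₁ k₂ x l) = f (shiftedRunCount k₁ k₂ x 0 n) +
      ∑ i ∈ Finset.range (k₁ + k₂ - 1), runIndicator k₁ k₂ x (i + 1 + 1 + (n - (k₁ + k₂))) *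
        (f (shiftedRunCount k₁ k₂ x (i + 1) (n - (k₁ + k₂)) + 1) -
          f (shiftedRunCount k₁ k₂ x (i + 1) (n - (k₁ + k₂)))) := by
  set k := k₁ + k₂ with hkdef
  have hper' : ∀ j, runIndicator k₁ k₂ x (j + 1 + n) = runIndicator k₁ k₂ x (j + 1) := by
    intro j
    have : runIndicator k₁ k₂ x (j + 1 + n) = runIndicator k₁ k₂ (fun i => x (i + n)) (j + 1) := by
      simp only [runIndicator]
      congr 1 <;> refine Finset.prod_congr rfl fun i _ => ?_
      · rw [show j + 1 + n + i = j + 1 + i + n by omega]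
      · rw [show j + 1 + n + k₁ + i = j + 1 + k₁ + i + n by omega]
    rw [this]
    refine runIndicator_congr fun i _ => ?_
    rw [show j + 1 + i = (j + i) + 1 by omega]
    exact hper _
  have e : ∑ l ∈ Finset.Icc 1 n, runIndicator k₁ k₂ x l = shiftedRunCount k₁ k₂ x 0 n +
      ∑ i ∈ Finset.range (k - 1), runIndicator k₁ k₂ x (i + 1 + 1 + (n - k)) := by
    rw [shiftedRunCount, ← hkdef, ← Finset.Ico_add_one_right_eq_Icc, Finset.sum_Ico_eq_sum_range,
      show n + 1 - 1 = (n + 1 - k) + (k - 1) by omega, Finset.sum_range_add]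
    congr 1
    refine Finset.sum_congr rfl fun i hi => ?_
    rw [Finset.mem_range] at hi
    congr 1; omega
  by_cases hall : ∀ i ∈ Finset.range (k - 1), runIndicator k₁ k₂ x (i + 1 + 1 + (n - k)) = 0
  · rw [e, Finset.sum_eq_zero hall, add_zero, Finset.sum_eq_zero, add_zero]
    intro i hi
    rw [hall i hi]; simp
  · push Not at hall
    obtain ⟨i₀, hi₀, hne⟩ := hall
    have hlt := Finset.mem_range.mp hi₀
    have hother : ∀ i ∈ Finset.range (k - 1), i ≠ i₀ →
        runIndicator k₁ k₂ x (i + 1 + 1 + (n - k)) = 0 := by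
      intro i hi hii
      rw [Finset.mem_range] at hi
      rcases lt_or_gt_of_ne hii with h | h
      · by_contra hne'
        exact hne (runIndicator_eq_zero_of_overlap hk (by omega) (by omega) hne')
      · exact runIndicator_eq_zero_of_overlap hk (by omega) (by omega) hne
    have hone : runIndicator k₁ k₂ x (i₀ + 1 + 1 + (n - k)) = 1 := by
      have := runIndicator_le_one (k₁ := k₁) (k₂ := k₂) hx (i₀ + 1 + 1 + (n - k))
      omega
    have hR : shiftedRunCount k₁ k₂ x 0 n = shiftedRunCount k₁ k₂ x (i₀ + 1) (n - k) := by
      rw [shiftedRunCount, shiftedRunCount, ← hkdef,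
        show n + 1 - k = (i₀ + 1) + (n - k + 1 - k) + (k - 1 - i₀) by omega,
        Finset.sum_range_add, Finset.sum_range_add, Finset.sum_eq_zero, zero_add,
        Finset.sum_eq_zero (s := Finset.range (k - 1 - i₀)), add_zero]
      · refine Finset.sum_congr rfl fun i _ => ?_
        congr 1; omega
      · intro j hj
        rw [Finset.mem_range] at hj
        by_contra hne'
        exact hne (runIndicator_eq_zero_of_overlap hk (by omega) (by omega) hne')
      · intro j hj
        rw [Finset.mem_range] at hj
        rw [show 0 + 1 + j = j + 1 by omega, ← hper' j]
        exact runIndicator_eq_zero_of_overlap hk (by omega) (by omega) hne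
    rw [e, Finset.sum_eq_single_of_mem i₀ hi₀ hother, hone, hR, Finset.sum_eq_single_of_mem i₀ hi₀
      fun i hi hii => by rw [hother i hi hii]; simp, hone]
    simp

variable {Ω : Type*} [MeasurableSpace Ω] {μ : Measure Ω}

theorem integrable_comp_of_finite [IsFiniteMeasure μ] {ι : Type*} [Countable ι]
    [MeasurableSpace ι] [MeasurableSingletonClass ι] {W : Ω → ι} (hW : Measurable W)
    (t : Finset ι) (ht : ∀ ω, W ω ∈ t) (f : ι → ℝ) : Integrable (fun ω => f (W ω)) μ := by
  refine Integrable.of_bound ((measurable_of_countable f).comp hW).aestronglyMeasurable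
    (∑ i ∈ t, |f i|) (Filter.Eventually.of_forall fun ω => ?_)
  rw [Real.norm_eq_abs]
  exact Finset.single_le_sum (f := fun i => |f i|) (fun i _ => abs_nonneg _) (ht ω)

/-- Bernoulli trials with success probability `p`, any `n` consecutive ones being independent. -/
structure IsBernoulliTrials (μ : Measure Ω) (y : ℕ → Ω → ℕ) (n : ℕ) (p : ℝ) : Prop where
  measurable : ∀ j, Measurable (y j)
  le_one : ∀ j ω, y j ω ≤ 1
  indep : ∀ s, iIndepFun (fun i : Fin n => y (s + 1 + i)) μ
  mean : ∀ j, ∫ ω, (y j ω : ℝ) ∂μ = p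

namespace IsBernoulliTrials

variable {y : ℕ → Ω → ℕ} {n : ℕ} {p : ℝ}

theorem measurable_runIndicator (hy : IsBernoulliTrials μ y n p) (l : ℕ) :
    Measurable fun ω => runIndicator k₁ k₂ (fun j => y j ω) l := by
  have hm := hy.measurable
  simp only [runIndicator]
  refine Measurable.mul (Finset.measurable_fun_prod _ fun i _ => ?_)
    (Finset.measurable_fun_prod _ fun i _ => hm _)
  exact (measurable_of_countable fun v : ℕ => 1 - v).comp (hm _)

theorem measurable_shiftedRunCount (hy : IsBernoulliTrials μ y n p) (s N : ℕ) :
    Measurable fun ω => shiftedRunCount k₁ k₂ (fun j => y j ω) s N :=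
  Finset.measurable_fun_sum _ fun _ _ => hy.measurable_runIndicator _

theorem integral_runIndicator [IsProbabilityMeasure μ] (hy : IsBernoulliTrials μ y n p) (s : ℕ)
    {m : ℕ} (hm : m + (k₁ + k₂) ≤ n) :
    ∫ ω, (runIndicator k₁ k₂ (fun j => y j ω) (s + 1 + m) : ℝ) ∂μ = (1 - p) ^ k₁ * p ^ k₂ := by
  let e : Fin k₁ ⊕ Fin k₂ → Fin n := Sum.elim (fun i => ⟨m + i, by omega⟩)
    (fun i => ⟨m + k₁ + i, by omega⟩)
  have he : Function.Injective e := by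
    rintro (i | i) (j | j) h <;> simp only [e, Sum.elim_inl, Sum.elim_inr, Fin.mk.injEq] at h
    · congr 1; ext; omega
    · omega
    · omega
    · congr 1; ext; omega
  have hind := (hy.indep s).precomp he
  let φ : Fin k₁ ⊕ Fin k₂ → ℕ → ℝ := Sum.elim (fun _ v => 1 - v) (fun _ v => v)
  have hprod := hind.integral_fun_prod_comp (f := φ)
    (fun i => (hy.measurable _).aemeasurable)
    (fun i => (measurable_of_countable _).aestronglyMeasurable)
  rw [Fintype.prod_sum_type] at hprod
  have hInt : ∀ j, Integrable (fun ω => (y j ω : ℝ)) μ := fun j =>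
    integrable_comp_of_finite (hy.measurable j) (Finset.range 2)
      (fun ω => Finset.mem_range.mpr (by have := hy.le_one j ω; omega)) (fun v => (v : ℝ))
  have e1 : ∀ j, ∫ ω, (1 - (y j ω : ℝ)) ∂μ = 1 - p := fun j => by
    rw [integral_sub (integrable_const _) (hInt j), hy.mean]; simp
  simp only [φ, e, Sum.elim_inl, Sum.elim_inr, e1, hy.mean, Finset.prod_const, Finset.card_univ,
    Fintype.card_fin, Fintype.prod_sum_type] at hprod
  rw [← hprod]
  refine integral_congr_ae (Filter.Eventually.of_forall fun ω => ?_)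
  simp only [runIndicator]
  push_cast
  rw [Finset.prod_range, Finset.prod_range]
  congr 1
  · refine Finset.prod_congr rfl fun i _ => ?_
    rw [Nat.cast_sub (hy.le_one _ _), ← add_assoc]; simp
  · refine Finset.prod_congr rfl fun i _ => ?_
    rw [← add_assoc, ← add_assoc]

theorem integral_runIndicator_mul [IsProbabilityMeasure μ] (hy : IsBernoulliTrials μ y n p)
    (s : ℕ) {m : ℕ} (hm : m + (k₁ + k₂) ≤ n) (f : ℕ → ℝ) :
    ∫ ω, (runIndicator k₁ k₂ (fun j => y j ω) (s + 1 + m) : ℝ) *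
        f (shiftedRunCount k₁ k₂ (fun j => y j ω) s m) ∂μ =
      (1 - p) ^ k₁ * p ^ k₂ * ∫ ω, f (shiftedRunCount k₁ k₂ (fun j => y j ω) s m) ∂μ := by
  -- The count uses the first m trials of the window and the indicator the later ones; `extS` and
  -- `extT` make each a function of its own block.
  let S : Finset (Fin n) := Finset.univ.filter fun i => (i : ℕ) < m
  let T : Finset (Fin n) := Finset.univ.filter fun i => m ≤ (i : ℕ)
  have hST : Disjoint S T := Finset.disjoint_left.mpr fun i hi hi' => by
    simp only [S, T, Finset.mem_filter] at hi hi'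
    omega
  have hind := (hy.indep s).indepFun_finset S T hST fun i => hy.measurable _
  let extS : (S → ℕ) → ℕ → ℕ := fun v j =>
    if h : j - (s + 1) < m then
      v ⟨⟨j - (s + 1), by omega⟩, Finset.mem_filter.mpr ⟨Finset.mem_univ _, h⟩⟩ else 0
  let extT : (T → ℕ) → ℕ → ℕ := fun v j =>
    if h : m ≤ j - (s + 1) ∧ j - (s + 1) < n then
      v ⟨⟨j - (s + 1), h.2⟩, Finset.mem_filter.mpr ⟨Finset.mem_univ _, h.1⟩⟩ else 0
  have hcomp := hind.comp
    (φ := fun v => f (shiftedRunCount k₁ k₂ (extS v) s m))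
    (ψ := fun v => (runIndicator k₁ k₂ (extT v) (s + 1 + m) : ℝ))
    (measurable_of_countable _) (measurable_of_countable _)
  have eS : (fun v => f (shiftedRunCount k₁ k₂ (extS v) s m)) ∘
      (fun ω (i : S) => y (s + 1 + (i : Fin n)) ω) =
      fun ω => f (shiftedRunCount k₁ k₂ (fun j => y j ω) s m) := by
    funext ω
    simp only [Function.comp_apply]
    congr 1
    refine shiftedRunCount_congr fun i hi => ?_
    simp only [extS]
    rw [dif_pos (by omega)]
    congr 1; omega
  have eT : (fun v => (runIndicator k₁ k₂ (extT v) (s + 1 + m) : ℝ)) ∘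
      (fun ω (i : T) => y (s + 1 + (i : Fin n)) ω) =
      fun ω => (runIndicator k₁ k₂ (fun j => y j ω) (s + 1 + m) : ℝ) := by
    funext ω
    simp only [Function.comp_apply]
    congr 1
    refine runIndicator_congr fun i hi => ?_
    simp only [extT]
    rw [dif_pos (by omega)]
    congr 1; omega
  rw [eS, eT] at hcomp
  rw [hcomp.symm.integral_fun_mul_eq_mul_integral
    ((measurable_of_countable _).comp (hy.measurable_runIndicator _)).aestronglyMeasurable
    ((measurable_of_countable f).comp (hy.measurable_shiftedRunCount _ _)).aestronglyMeasurable,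
    hy.integral_runIndicator s hm]

theorem integrable_apply_shiftedRunCount [IsProbabilityMeasure μ] (hy : IsBernoulliTrials μ y n p)
    (s N : ℕ) (f : ℕ → ℝ) :
    Integrable (fun ω => f (shiftedRunCount k₁ k₂ (fun j => y j ω) s N)) μ :=
  integrable_comp_of_finite (hy.measurable_shiftedRunCount s N) (Finset.range (N + 2))
    (fun ω => Finset.mem_range.mpr (by
      have := shiftedRunCount_le (k₁ := k₁) (k₂ := k₂) (fun j => hy.le_one j ω) s N
      omega)) f

theorem integrable_runIndicator_mul [IsProbabilityMeasure μ] (hy : IsBernoulliTrials μ y n p)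
    (l s N : ℕ) (f : ℕ → ℝ) :
    Integrable (fun ω => (runIndicator k₁ k₂ (fun j => y j ω) l : ℝ) *
      f (shiftedRunCount k₁ k₂ (fun j => y j ω) s N)) μ :=
  integrable_comp_of_finite (W := fun ω => (runIndicator k₁ k₂ (fun j => y j ω) l,
      shiftedRunCount k₁ k₂ (fun j => y j ω) s N))
    ((hy.measurable_runIndicator l).prodMk (hy.measurable_shiftedRunCount s N))
    (Finset.range 2 ×ˢ Finset.range (N + 2))
    (fun ω => Finset.mem_product.mpr ⟨Finset.mem_range.mpr (by
      have := runIndicator_le_one (k₁ := k₁) (k₂ := k₂) (fun j => hy.le_one j ω) l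
      simp only; omega), Finset.mem_range.mpr (by
      have := shiftedRunCount_le (k₁ := k₁) (k₂ := k₂) (fun j => hy.le_one j ω) s N
      simp only; omega)⟩) (fun v => (v.1 : ℝ) * f v.2)

theorem integral_apply_shiftedRunCount [IsProbabilityMeasure μ] (hy : IsBernoulliTrials μ y n p)
    (hk : (1 ≤ k₁ ∧ 1 ≤ k₂) ∨ k₁ + k₂ = 1) (s : ℕ) {N : ℕ} (hN : N ≤ n) (f : ℕ → ℝ) :
    ∫ ω, f (shiftedRunCount k₁ k₂ (fun j => y j ω) s N) ∂μ =
      pairing f (runPoly ((1 - p) ^ k₁ * p ^ k₂) (k₁ + k₂) N) := by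
  induction N using Nat.strong_induction_on generalizing f with
  | _ N ih =>
    rcases lt_or_ge N (k₁ + k₂) with h | h
    · rw [runPoly_of_lt h]
      have h1 : (1 : ℝ[X]) = monomial 0 1 := by simp
      rw [h1, pairing_monomial]
      simp [shiftedRunCount, show N + 1 - (k₁ + k₂) = 0 by omega]
    · simp_rw [fun ω => apply_shiftedRunCount hk (fun j => hy.le_one j ω) s h f]
      rw [integral_add (hy.integrable_apply_shiftedRunCount _ _ f)
        (hy.integrable_runIndicator_mul _ s (N - (k₁ + k₂)) fun m => f (m + 1) - f m),
        hy.integral_runIndicator_mul s (by omega) (fun m => f (m + 1) - f m),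
        ih (N - 1) (by omega) (by omega), ih (N - (k₁ + k₂)) (by omega) (by omega) (fun m => f (m + 1) - f m),
        runPoly_of_le (by omega) h, map_add, mul_assoc (C _), pairing_C_mul, pairing_X_sub_one_mul]

theorem integral_apply_cyclic_sum [IsProbabilityMeasure μ] (hy : IsBernoulliTrials μ y n p)
    (hk : (1 ≤ k₁ ∧ 1 ≤ k₂) ∨ k₁ + k₂ = 1) (hn : 2 * (k₁ + k₂) ≤ n)
    (hper : ∀ j, y (j + 1 + n) = y (j + 1)) (f : ℕ → ℝ) :
    ∫ ω, f (∑ l ∈ Finset.Icc 1 n, runIndicator k₁ k₂ (fun j => y j ω) l) ∂μ =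
      pairing f (cyclicRunPoly ((1 - p) ^ k₁ * p ^ k₂) (k₁ + k₂ : ℕ) n) := by
  simp_rw [fun ω => apply_cyclic_sum hk (fun j => hy.le_one j ω) hn
    (fun j => congrFun (hper j) ω) f]
  have hterm := fun i => hy.integrable_runIndicator_mul (k₁ := k₁) (k₂ := k₂)
    (i + 1 + 1 + (n - (k₁ + k₂))) (i + 1) (n - (k₁ + k₂)) fun m => f (m + 1) - f m
  rw [integral_add (hy.integrable_apply_shiftedRunCount _ _ f)
    (integrable_finsetSum _ fun i _ => hterm i), integral_finsetSum _ fun i _ => hterm i,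
    hy.integral_apply_shiftedRunCount hk 0 le_rfl f]
  rw [Finset.sum_congr rfl fun i _ => (hy.integral_runIndicator_mul (i + 1) (by omega)
      (fun m => f (m + 1) - f m)).trans (congrArg _ (hy.integral_apply_shiftedRunCount hk (i + 1)
      (show n - (k₁ + k₂) ≤ n by omega) (fun m => f (m + 1) - f m)))]
  rw [Finset.sum_const, Finset.card_range, nsmul_eq_mul, cyclicRunPoly, map_add, mul_assoc (C _),
    pairing_C_mul, pairing_X_sub_one_mul, Nat.cast_sub (by omega)]
  push_cast
  ring

end IsBernoulliTrials

end RunLaws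

/-! ### Stein's method for the cyclic count, and tail bounds. -/

section RunApproximation
open Polynomial

variable {a α r : ℝ} {k n : ℕ}

theorem eval_one_cyclicRunPoly (hk : 1 ≤ k) : (cyclicRunPoly a k n).eval 1 = 1 := by
  simp [cyclicRunPoly, eval_one_runPoly hk]

theorem eval_one_derivative_cyclicRunPoly (hk : 1 ≤ k) (hn : k ≤ n) :
    (derivative (cyclicRunPoly a k n)).eval 1 = n * a := by
  rw [derivative_cyclicRunPoly hk hn, eval_mul, eval_C, eval_one_runPoly hk, mul_one]

theorem pgfVariance_cyclicRunPoly (hk : 1 ≤ k) (hn : 2 * k ≤ n) :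
    pgfVariance (cyclicRunPoly a k n) = n * a * (1 - (2 * k - 1) * a) := by
  rw [pgfVariance, eval_one_derivative_cyclicRunPoly hk (by omega),
    derivative_cyclicRunPoly hk (by omega), derivative_mul, derivative_C, zero_mul, zero_add,
    eval_mul, eval_C, eval_one_derivative_runPoly hk, Nat.cast_sub (by omega)]
  push_cast [Nat.cast_sub (show k ≤ n by omega)]
  ring

/-- By T' = na L_{n-k}, every term with a factor m becomes a pairing with L_{n-k}. What remains is
na times g(·+1) paired with T - L_{n-k} - r(X-1)L_{n-k}, and r = (2k-1)a is the value for which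
`cyclicRunPoly_sub` leaves only second order. -/
theorem pairing_stein_operator_cyclicRunPoly (hk : 1 ≤ k) (hn : 4 * k ≤ n)
    (hmean : α * r = n * a) (hr : r = (2 * k - 1) * a) (g : ℕ → ℝ) :
    pairing (fun m => (α - m) * r * g (m + 1) - m * (1 - r) * g m) (cyclicRunPoly a k n) =
      -(n * a ^ 3 * ∑ j ∈ Finset.range k, ∑ i ∈ Finset.range j,
        pairing (fun m => g (m + 2) - g (m + 1))
          ((X - 1) * runPoly a k (n - k - j + 1 + i - k))) := by
  have e : (fun m : ℕ => (α - m) * r * g (m + 1) - m * (1 - r) * g m) =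
      fun m : ℕ => ((α * r) * g (m + 1) - r * (m * (g (m + 1) - g m))) - m * g m := by
    funext m; ring
  have h1 := cyclicRunPoly_sub (a := a) hk hn
  have h2 := congrArg (pairing fun m => g (m + 1)) h1
  rw [map_sub, map_sub, pairing_C_mul, map_neg, pairing_C_mul, pairing_X_sub_one_mul,
    pairing_X_sub_one_mul, Finset.mul_sum, map_sum,
    Finset.sum_congr rfl fun j _ => by rw [Finset.mul_sum, map_sum]] at h2
  rw [e, pairing_sub_fun, pairing_sub_fun, pairing_const_mul_fun, pairing_const_mul_fun,
    pairing_cast_mul, pairing_cast_mul g,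
    derivative_cyclicRunPoly hk (by omega), pairing_X_mul, pairing_X_mul, pairing_C_mul,
    pairing_C_mul, hmean, hr]
  linear_combination (n * a) * h2

theorem smoothing_radius_mono {s t : ℝ} (hs : 0 < s) (hst : s ≤ t) :
    min 1 (3 / √t) ≤ min 1 (3 / √s) := by
  have := Real.sqrt_pos.mpr hs
  have := Real.sqrt_le_sqrt hst
  gcongr

theorem abs_pairing_cyclicRunPoly_sub_pseudoBinomial_le (ha : 0 < a) (hk : 1 ≤ k)
    (hn : 4 * k ≤ n) (hka : 2 ≤ k → (2 * k - 1) * a ≤ 8 / 9)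
    (hL : ∀ N ≤ n, ∀ m, 0 ≤ (runPoly a k N).coeff m)
    (hT : ∀ m, 0 ≤ (cyclicRunPoly a k n).coeff m)
    (hα : 0 < α) (hr0 : 0 < r) (hr1 : r < 1) (hK : 1 ≤ ⌊α⌋₊)
    (hmean : α * r = n * a) (hr : r = (2 * k - 1) * a)
    {h : ℕ → ℝ} (h0 : ∀ m, 0 ≤ h m) (h1 : ∀ m, h m ≤ 1) :
    |pairing h (cyclicRunPoly a k n)
        - ∑ j ∈ Finset.range (⌊α⌋₊ + 1), h j * pseudoBinomialPMF α r j| ≤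
      n * a ^ 3 * (k * (k - 1)) * (1 / (⌊α⌋₊ * r * (1 - r)))
          * min 1 (3 / √(((n : ℝ) - 4 * k + 2) * a))
        + pairing (fun m => if ⌊α⌋₊ < m then 1 else 0) (cyclicRunPoly a k n) := by
  obtain ⟨g, hg1, hg2, hg3⟩ := exists_pseudoBinomial_stein_solution hα hr0 hr1 hK h0 h1
  set w := ∑ j ∈ Finset.range (⌊α⌋₊ + 1), h j * pseudoBinomialPMF α r j with hw
  set T := cyclicRunPoly a k n with hTdef
  set b := 1 / (⌊α⌋₊ * r * (1 - r)) with hb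
  set δ := min 1 (3 / √(((n : ℝ) - 4 * k + 2) * a)) with hδ
  have hb0 : 0 ≤ b := (abs_nonneg _).trans (hg3 0)
  have hw0 : 0 ≤ w := Finset.sum_nonneg fun j hj => mul_nonneg (h0 j)
    (pseudoBinomialPMF_pos hα hr0 hr1 (by rw [Finset.mem_range] at hj; omega)).le
  have hw1 : w ≤ 1 := by
    rw [← sum_pseudoBinomialPMF hα hr0 hr1]
    exact Finset.sum_le_sum fun j hj => mul_le_of_le_one_left
      (pseudoBinomialPMF_pos hα hr0 hr1 (by rw [Finset.mem_range] at hj; omega)).le (h1 j)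
  set A : ℕ → ℝ := fun m => (α - m) * r * g (m + 1) - m * (1 - r) * g m with hA
  have split : pairing h T - w = pairing A T + pairing (fun m => (h m - w) - A m) T := by
    rw [pairing_sub_fun (fun m => h m - w), pairing_sub_fun h, pairing_const,
      eval_one_cyclicRunPoly hk]
    ring
  -- Beyond ⌊α⌋ the solution is zero, so the defect there is h - w, of modulus at most 1.
  have hrem : ∀ m, |(h m - w) - A m| ≤ if ⌊α⌋₊ < m then 1 else 0 := by
    intro m
    split_ifs with hm
    · simp only [hA, hg2 m hm, hg2 (m + 1) (by omega), mul_zero, sub_zero]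
      rw [abs_le]; constructor <;> linarith [h0 m, h1 m]
    · simp only [hA]
      rw [hg1 m (by omega)]; simp
  have hremT : |pairing (fun m => (h m - w) - A m) T| ≤
      pairing (fun m => if ⌊α⌋₊ < m then 1 else 0) T := by
    rw [abs_le]
    constructor
    · rw [neg_le, ← neg_one_mul, ← pairing_const_mul_fun]
      exact pairing_mono hT fun m => by rw [neg_one_mul]; exact (neg_le_abs _).trans (hrem m)
    · exact pairing_mono hT fun m => (le_abs_self _).trans (hrem m)
  have hmain : |pairing A T| ≤ n * a ^ 3 * (k * (k - 1)) * b * δ := by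
    have hsum : |∑ j ∈ Finset.range k, ∑ i ∈ Finset.range j,
        pairing (fun m => g (m + 2) - g (m + 1))
          ((X - 1) * runPoly a k (n - k - j + 1 + i - k))| ≤
        ∑ j ∈ Finset.range k, ∑ i ∈ Finset.range j, 2 * b * δ := by
      refine (Finset.abs_sum_le_sum_abs _ _).trans (Finset.sum_le_sum fun j hj => ?_)
      refine (Finset.abs_sum_le_sum_abs _ _).trans (Finset.sum_le_sum fun i hi => ?_)
      rw [Finset.mem_range] at hi hj
      refine (abs_pairing_X_sub_one_mul_runPoly_le ha hk (hka (by omega)) (by omega)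
        (hL _ (by omega)) hg3).trans ?_
      refine mul_le_mul_of_nonneg_left (smoothing_radius_mono ?_ ?_) (by positivity)
      · have : (4 * k : ℝ) ≤ n := by exact_mod_cast hn
        exact mul_pos (by linarith) ha
      · refine mul_le_mul_of_nonneg_right ?_ ha.le
        have : (n : ℤ) - 4 * k + 2 ≤ (n - k - j + 1 + i - k + 1 - k : ℕ) := by omega
        exact_mod_cast this
    have hcount : ∑ j ∈ Finset.range k, ∑ i ∈ Finset.range j, 2 * b * δ =
        (k * (k - 1)) * b * δ := by
      simp only [Finset.sum_const, Finset.card_range, nsmul_eq_mul]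
      rw [← Finset.sum_mul]
      have := congrArg (Nat.cast (R := ℝ)) (Finset.sum_range_id_mul_two k)
      push_cast [Nat.cast_sub hk] at this
      linear_combination b * δ * this
    rw [hA, pairing_stein_operator_cyclicRunPoly hk hn hmean hr, abs_neg, abs_mul,
      abs_of_nonneg (by positivity : (0 : ℝ) ≤ n * a ^ 3)]
    refine (mul_le_mul_of_nonneg_left (hsum.trans_eq hcount) (by positivity)).trans_eq (by ring)
  rw [split]
  exact (abs_add_le _ _).trans (add_le_add hmain hremT)

theorem abs_pairing_runPoly_sub_cyclicRunPoly_le (ha : 0 < a) (hk : 1 ≤ k)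
    (hn : 2 * k ≤ n) (hka : 2 ≤ k → (2 * k - 1) * a ≤ 8 / 9)
    (hL : ∀ m, 0 ≤ (runPoly a k (n - k)).coeff m)
    {h : ℕ → ℝ} (h0 : ∀ m, 0 ≤ h m) (h1 : ∀ m, h m ≤ 1) :
    |pairing h (runPoly a k n) - pairing h (cyclicRunPoly a k n)| ≤
      (k - 1) * a * min 1 (3 / √(((n : ℝ) - 2 * k + 1) * a)) := by
  rw [cyclicRunPoly, map_add, sub_add_cancel_left, abs_neg, mul_assoc (C _), pairing_C_mul, abs_mul]
  have hk' : (0 : ℝ) ≤ k - 1 := by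
    have : (1 : ℝ) ≤ k := by exact_mod_cast hk
    linarith
  rw [abs_of_nonneg (mul_nonneg hk' ha.le)]
  rcases Nat.lt_or_ge k 2 with h2 | h2
  · have : k = 1 := by omega
    subst this; simp
  · refine mul_le_mul_of_nonneg_left ?_ (mul_nonneg hk' ha.le)
    -- The factor X - 1 annihilates constants, so centring h at 1/2 halves its sup norm for free.
    have hc : pairing h ((X - 1) * runPoly a k (n - k)) =
        pairing (fun m => h m - 1 / 2) ((X - 1) * runPoly a k (n - k)) := by
      rw [pairing_sub_fun, pairing_const]; simp
    rw [hc]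
    refine (abs_pairing_X_sub_one_mul_runPoly_le ha hk (hka h2) (by omega) hL (c := 1 / 2)
      fun m => ?_).trans_eq ?_
    · rw [abs_le]; constructor <;> linarith [h0 m, h1 m]
    · rw [Nat.cast_sub (by omega)]
      push_cast [Nat.cast_sub (show k ≤ n by omega)]
      ring_nf

/-- Markov's inequality for M(M-1), whose mean is na times the mean of L_{n-k}, hence at most (na)².
It serves when na is small. -/
theorem pairing_tail_cyclicRunPoly_le_sq (hk : 1 ≤ k) (hn : 2 * k ≤ n) (ha : 0 < a)
    (hT : ∀ m, 0 ≤ (cyclicRunPoly a k n).coeff m) {K : ℕ} (hK : 1 ≤ K) :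
    pairing (fun m => if K < m then 1 else 0) (cyclicRunPoly a k n) ≤
      (n * a) ^ 2 / (K * (K + 1)) := by
  have hK0 : (1 : ℝ) ≤ K := by exact_mod_cast hK
  have hmono := pairing_mono (f := fun m => if K < m then (1 : ℝ) else 0)
    (g := fun m : ℕ => 1 / (K * (K + 1)) * (m * ((m : ℝ) - 1))) hT fun m => by
      have hm : (0 : ℝ) ≤ m * ((m : ℝ) - 1) := by
        rcases Nat.eq_zero_or_pos m with rfl | hm
        · simp
        · have : (1 : ℝ) ≤ m := by exact_mod_cast hm
          exact mul_nonneg (by linarith) (by linarith)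
      split_ifs with h
      · have : (K : ℝ) + 1 ≤ m := by exact_mod_cast h
        rw [one_div, ← div_eq_inv_mul, le_div_iff₀ (by positivity), one_mul]
        nlinarith
      · positivity
  refine hmono.trans ?_
  rw [pairing_const_mul_fun, pairing_cast_mul, derivative_cyclicRunPoly hk (by omega),
    pairing_X_mul, pairing_C_mul, one_div, ← div_eq_inv_mul]
  refine div_le_div_of_nonneg_right ?_ (by positivity)
  have e : (fun m : ℕ => ((m + 1 : ℕ) : ℝ) - 1) = fun m : ℕ => (m : ℝ) * 1 := by
    funext m; push_cast; ring
  rw [e, pairing_cast_mul, pairing_const, eval_mul, eval_X, eval_one_derivative_runPoly hk, sq]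
  refine mul_le_mul_of_nonneg_left ?_ (by positivity)
  have : ((n - k + 1 - k : ℕ) : ℝ) ≤ n := by exact_mod_cast (show n - k + 1 - k ≤ n by omega)
  nlinarith

/-- An integer above ⌊α⌋ exceeds α, hence exceeds the mean αr by more than α(1-r), while the
variance is αr(1-r). It serves when na is large. -/
theorem pairing_tail_cyclicRunPoly_le_chebyshev (hk : 1 ≤ k) (hn : 2 * k ≤ n)
    (hT : ∀ m, 0 ≤ (cyclicRunPoly a k n).coeff m) (hα : 0 < α) (hr0 : 0 < r) (hr1 : r < 1)
    (hmean : α * r = n * a) (hr : r = (2 * k - 1) * a) :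
    pairing (fun m => if ⌊α⌋₊ < m then 1 else 0) (cyclicRunPoly a k n) ≤
      r / (α * (1 - r)) := by
  have hq : 0 < 1 - r := by linarith
  have hmono := pairing_mono (f := fun m => if ⌊α⌋₊ < m then (1 : ℝ) else 0)
    (g := fun m : ℕ => 1 / (α * (1 - r)) ^ 2 *
      ((m : ℝ) - (derivative (cyclicRunPoly a k n)).eval 1) ^ 2) hT fun m => by
      rw [eval_one_derivative_cyclicRunPoly hk (by omega), ← hmean]
      split_ifs with h
      · have h2 : α < m := (Nat.floor_lt hα.le).mp h
        rw [one_div, ← div_eq_inv_mul, le_div_iff₀ (by positivity), one_mul]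
        refine pow_le_pow_left₀ (by positivity) ?_ 2
        linarith
      · positivity
  refine hmono.trans_eq ?_
  rw [pairing_const_mul_fun, pairing_sq_sub_mean (eval_one_cyclicRunPoly hk),
    pgfVariance_cyclicRunPoly hk hn, ← hmean, ← hr]
  field_simp

/-- Let x be the larger of p and 1 - p. Turning all but one of the smaller factors into x reduces
the claim to (2j+1)x^j(1-x) with j = k - 1. For j ≥ 2 this is at most 2/e + 4/27 < 8/9; for j = 1 it
is at most 3/4. -/
theorem mul_pow_mul_pow_le {k₁ k₂ : ℕ} (h1 : 1 ≤ k₁) (h2 : 1 ≤ k₂) {p : ℝ} (hp0 : 0 ≤ p)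
    (hp1 : p ≤ 1) : (2 * (k₁ + k₂ : ℕ) - 1) * ((1 - p) ^ k₁ * p ^ k₂) ≤ 8 / 9 := by
  have key : ∀ (x : ℝ) (j : ℕ), 0 ≤ x → x ≤ 1 → 1 ≤ j →
      (2 * j + 1) * (x ^ j * (1 - x)) ≤ 8 / 9 := by
    intro x j hx0 hx1 hj
    rcases hj.eq_or_lt with rfl | hj
    · norm_num; nlinarith [sq_nonneg (x - 1 / 2)]
    · have e1 : x ^ j ≤ Real.exp (-(j * (1 - x))) := by
        have := pow_le_pow_left₀ hx0 (by simpa using Real.one_sub_le_exp_neg (1 - x)) j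
        rwa [← Real.exp_nat_mul, show j * (x - 1) = -(j * (1 - x)) by ring] at this
      have e2 : j * (1 - x) * Real.exp (-(j * (1 - x))) ≤ Real.exp (-1) := by
        have := Real.add_one_le_exp (j * (1 - x) - 1)
        rw [sub_add_cancel] at this
        calc _ ≤ Real.exp (j * (1 - x) - 1) * Real.exp (-(j * (1 - x))) :=
              mul_le_mul_of_nonneg_right this (Real.exp_pos _).le
          _ = Real.exp (-1) := by rw [← Real.exp_add]; ring_nf
      have e3 : x ^ j ≤ x ^ 2 := pow_le_pow_of_le_one hx0 hx1 hj
      have e4 : x ^ 2 * (1 - x) ≤ 4 / 27 := by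
        nlinarith [mul_nonneg (sq_nonneg (x - 2 / 3)) (by linarith : 0 ≤ x + 1 / 3)]
      have e5 := Real.exp_neg_one_lt_d9
      have e6 := mul_le_mul_of_nonneg_left e1 (by positivity : 0 ≤ j * (1 - x))
      have e7 := mul_le_mul_of_nonneg_right e3 (by linarith : 0 ≤ 1 - x)
      nlinarith
  have hq0 : 0 ≤ 1 - p := by linarith
  have hcast : (2 * (k₁ + k₂ : ℕ) - 1 : ℝ) = 2 * (k₁ + k₂ - 1 : ℕ) + 1 := by
    push_cast [Nat.cast_sub (show 1 ≤ k₁ + k₂ by omega)]; ring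
  rw [hcast]
  have hcoef : (0 : ℝ) ≤ 2 * (k₁ + k₂ - 1 : ℕ) + 1 := by positivity
  rcases le_total p (1 - p) with h | h
  · refine (mul_le_mul_of_nonneg_left ?_ hcoef).trans
      (key (1 - p) (k₁ + k₂ - 1) hq0 (by linarith) (by omega))
    rw [sub_sub_cancel, show k₁ + k₂ - 1 = k₁ + (k₂ - 1) by omega, pow_add, mul_assoc]
    refine mul_le_mul_of_nonneg_left ?_ (by positivity)
    obtain ⟨j, rfl⟩ : ∃ j, k₂ = j + 1 := ⟨k₂ - 1, by omega⟩
    rw [pow_succ, Nat.add_sub_cancel]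
    exact mul_le_mul_of_nonneg_right (pow_le_pow_left₀ hp0 h j) hp0
  · refine (mul_le_mul_of_nonneg_left ?_ hcoef).trans
      (key p (k₁ + k₂ - 1) hp0 hp1 (by omega))
    rw [show k₁ + k₂ - 1 = (k₁ - 1) + k₂ by omega, pow_add, mul_right_comm]
    refine mul_le_mul_of_nonneg_right ?_ (by positivity)
    obtain ⟨j, rfl⟩ : ∃ j, k₁ = j + 1 := ⟨k₁ - 1, by omega⟩
    rw [pow_succ, Nat.add_sub_cancel]
    exact mul_le_mul_of_nonneg_right (pow_le_pow_left₀ hq0 h j) hq0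

end RunApproximation

/-! ### Total variation distance and expectations of indicators. -/

section TotalVariation

theorem dTV_le {Ω Ω' E : Type*} [MeasurableSpace Ω] [MeasurableSpace Ω'] [MeasurableSpace E]
    {μ : Measure Ω} {X : Ω → E} {ν : Measure Ω'} {Y : Ω' → E} {D : ℝ}
    (h : ∀ S, MeasurableSet S → |μ.real (X ⁻¹' S) - ν.real (Y ⁻¹' S)| ≤ D) : dTV μ X ν Y ≤ D :=
  haveI : Nonempty {S : Set E // MeasurableSet S} := ⟨⟨∅, MeasurableSet.empty⟩⟩
  ciSup_le fun S => h S.1 S.2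

theorem le_dTV {Ω Ω' E : Type*} [MeasurableSpace Ω] [MeasurableSpace Ω'] [MeasurableSpace E]
    {μ : Measure Ω} [IsProbabilityMeasure μ] {X : Ω → E} {ν : Measure Ω'} [IsProbabilityMeasure ν]
    {Y : Ω' → E} {S : Set E} (hS : MeasurableSet S) :
    |μ.real (X ⁻¹' S) - ν.real (Y ⁻¹' S)| ≤ dTV μ X ν Y := by
  refine le_ciSup (f := fun S : {S : Set E // MeasurableSet S} =>
    |μ.real (X ⁻¹' S.1) - ν.real (Y ⁻¹' S.1)|) ⟨1, ?_⟩ ⟨S, hS⟩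
  rintro _ ⟨S, rfl⟩
  have h1 : μ.real (X ⁻¹' S.1) ≤ 1 := measureReal_le_one
  have h2 : ν.real (Y ⁻¹' S.1) ≤ 1 := measureReal_le_one
  have h3 : 0 ≤ μ.real (X ⁻¹' S.1) := measureReal_nonneg
  have h4 : 0 ≤ ν.real (Y ⁻¹' S.1) := measureReal_nonneg
  rw [abs_le]; constructor <;> linarith

theorem dTV_triangle {Ω Ω' Ω'' E : Type*} [MeasurableSpace Ω] [MeasurableSpace Ω']
    [MeasurableSpace Ω''] [MeasurableSpace E] (μ : Measure Ω) [IsProbabilityMeasure μ] (X : Ω → E)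
    (ν : Measure Ω') [IsProbabilityMeasure ν] (Y : Ω' → E) (ρ : Measure Ω'')
    [IsProbabilityMeasure ρ] (Z : Ω'' → E) :
    dTV μ X ρ Z ≤ dTV μ X ν Y + dTV ν Y ρ Z :=
  dTV_le fun _ hS => (abs_sub_le _ _ _).trans (add_le_add (le_dTV hS) (le_dTV hS))

theorem measureReal_preimage_eq_integral {Ω : Type*} [MeasurableSpace Ω] {μ : Measure Ω}
    {X : Ω → ℕ} (hX : AEMeasurable X μ) (S : Set ℕ) :
    μ.real (X ⁻¹' S) = ∫ ω, S.indicator 1 (X ω) ∂μ := by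
  have h : (fun ω => S.indicator (1 : ℕ → ℝ) (X ω)) = (X ⁻¹' S).indicator 1 := by
    funext ω
    rfl
  rw [h, integral_indicator₀ (hX.nullMeasurableSet_preimage (MeasurableSet.of_discrete))]
  simp

theorem measureReal_preimage_eq_sum {Ω : Type*} [MeasurableSpace Ω] {ν : Measure Ω}
    [IsProbabilityMeasure ν] {Z : Ω → ℕ} (hZ : Measurable Z) {w : ℕ → ℝ} {n : ℕ}
    (h : ∀ m, ν.real {ω | Z ω = m} = w m) (hw : ∑ m ∈ Finset.range n, w m = 1) (S : Set ℕ) :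
    ν.real (Z ⁻¹' S) = ∑ m ∈ Finset.range n, S.indicator 1 m * w m := by
  have lower : ∀ S : Set ℕ, ∑ m ∈ Finset.range n, S.indicator 1 m * w m ≤ ν.real (Z ⁻¹' S) := by
    intro S
    classical
    have e : ∑ m ∈ Finset.range n, S.indicator 1 m * w m =
        ∑ m ∈ (Finset.range n).filter (· ∈ S), ν.real (Z ⁻¹' {m}) := by
      rw [Finset.sum_filter]
      refine Finset.sum_congr rfl fun m _ => ?_
      rw [← h m, Set.indicator_apply]
      split_ifs
      · rw [Pi.one_apply, one_mul]; rfl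
      · rw [zero_mul]
    rw [e, sum_measureReal_preimage_singleton _ fun m _ => hZ (measurableSet_singleton m)]
    refine measureReal_mono (Set.preimage_mono fun m hm => ?_)
    simp only [Finset.coe_filter, Set.mem_ofPred_eq] at hm
    exact hm.2
  have hc : ν.real (Z ⁻¹' Sᶜ) = 1 - ν.real (Z ⁻¹' S) := by
    rw [Set.preimage_compl, probReal_compl_eq_one_sub (hZ MeasurableSet.of_discrete)]
  have hs : ∑ m ∈ Finset.range n, S.indicator 1 m * w m +
      ∑ m ∈ Finset.range n, Sᶜ.indicator 1 m * w m = 1 := by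
    rw [← hw, ← Finset.sum_add_distrib]
    refine Finset.sum_congr rfl fun m _ => ?_
    rw [← add_mul, ← Pi.add_apply, Set.indicator_self_add_compl, Pi.one_apply, one_mul]
  have h1 := lower S
  -- The lower bounds for S and its complement both sum to 1, so each is an equality; no countable
  -- sum is needed.
  have h2 := lower Sᶜ
  linarith

end TotalVariation

/-! ### Periodic extension of the trials. -/

section Trials

variable {Ω : Type*} [MeasurableSpace Ω] {μ : Measure Ω}

theorem exists_isBernoulliTrials [IsProbabilityMeasure μ] {n : ℕ} (hn : 1 ≤ n) {p : ℝ}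
    {ξ : ℕ → Ω → ℕ} (hmeas : ∀ l ∈ Finset.Icc 1 n, Measurable (ξ l))
    (hindep : iIndepFun (fun l : Finset.Icc 1 n => ξ l) μ)
    (hone : ∀ l ∈ Finset.Icc 1 n, μ.real {ω | ξ l ω = 1} = p)
    (hzero : ∀ l ∈ Finset.Icc 1 n, μ.real {ω | ξ l ω = 0} = 1 - p) :
    ∃ y : ℕ → Ω → ℕ, IsBernoulliTrials μ y n p ∧ (∀ j, y (j + 1 + n) = y (j + 1)) ∧
      ∀ᵐ ω ∂μ, ∀ j, ξ ((j - 1) % n + 1) ω = y j ω := by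
  have hmem : ∀ j, (j - 1) % n + 1 ∈ Finset.Icc 1 n := fun j => by
    have := Nat.mod_lt (j - 1) (show 0 < n by omega)
    rw [Finset.mem_Icc]; omega
  -- The given trials are 0-1 valued only almost surely; truncation makes this hold everywhere, as
  -- the pathwise identities require.
  let b : ℕ → ℕ := fun v => if v = 1 then 1 else 0
  have hb : Measurable b := measurable_of_countable b
  refine ⟨fun j ω => b (ξ ((j - 1) % n + 1) ω), ⟨fun j => hb.comp (hmeas _ (hmem j)),
    fun j ω => ?_, fun s => ?_, fun j => ?_⟩, fun j => ?_, ?_⟩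
  · simp only [b]; split_ifs <;> omega
  · let e : Fin n → Finset.Icc 1 n := fun i => ⟨(s + 1 + i - 1) % n + 1, hmem _⟩
    have he : Function.Injective e := by
      intro i j hij
      simp only [e, Subtype.mk.injEq] at hij
      have h1 : s + i ≡ s + j [MOD n] := by
        have h2 : (s + 1 + i - 1) % n = (s + 1 + j - 1) % n := by omega
        rwa [show s + 1 + (i : ℕ) - 1 = s + i by omega,
          show s + 1 + (j : ℕ) - 1 = s + j by omega] at h2
      exact Fin.ext ((Nat.ModEq.add_left_cancel' s h1).eq_of_lt_of_lt i.2 j.2)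
    exact (hindep.precomp he).comp (fun _ => b) fun _ => hb
  · have h1 : (fun ω => ((b (ξ ((j - 1) % n + 1) ω) : ℕ) : ℝ)) =
        fun ω => ({1} : Set ℕ).indicator 1 (ξ ((j - 1) % n + 1) ω) := by
      funext ω
      simp only [b, Set.indicator, Set.mem_singleton_iff]
      split_ifs <;> simp
    rw [h1, ← measureReal_preimage_eq_integral (hmeas _ (hmem j)).aemeasurable]
    exact hone _ (hmem j)
  · simp only [show j + 1 + n - 1 = j + n by omega, show j + 1 - 1 = j by omega,
      Nat.add_mod_right]
  · rw [ae_all_iff]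
    intro j
    have h1 : μ.real (ξ ((j - 1) % n + 1) ⁻¹' {0, 1}) = 1 := by
      have h2 := sum_measureReal_preimage_singleton (μ := μ) ({0, 1} : Finset ℕ)
        (f := ξ ((j - 1) % n + 1)) fun v _ => hmeas _ (hmem j) (measurableSet_singleton v)
      rw [Finset.sum_pair (by norm_num), show μ.real (ξ ((j - 1) % n + 1) ⁻¹' {0}) = 1 - p from
        hzero _ (hmem j), show μ.real (ξ ((j - 1) % n + 1) ⁻¹' {1}) = p from hone _ (hmem j)] at h2
      rw [show (({0, 1} : Finset ℕ) : Set ℕ) = {0, 1} by simp] at h2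
      linarith
    have h2 : ∀ᵐ ω ∂μ, ω ∈ ξ ((j - 1) % n + 1) ⁻¹' {0, 1} :=
      (mem_ae_iff_prob_eq_one (hmeas _ (hmem j) MeasurableSet.of_discrete)).mpr
        ((ENNReal.toReal_eq_one_iff _).mp h1)
    filter_upwards [h2] with ω hω
    simp only [Set.mem_preimage, Set.mem_insert_iff, Set.mem_singleton_iff] at hω
    simp only [b]
    split_ifs <;> omega

end Trials

/-! ### Comparison with the stated constants. -/

section Arithmetic

theorem boundary_bound_arith {k n a : ℝ} (hk : 1 ≤ k) (hn : 4 * k ≤ n) (ha : 0 < a) {c : ℝ}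
    (hc0 : 0 < c) (hc1 : c ≤ 1) :
    (k - 1) * a * min 1 (3 / √((n - 2 * k + 1) * a)) ≤
      2 * (k - 1) * a * min 1 (2.3 / √((n - k - 1) * a * c)) := by
  have h1 : min 1 (3 / √((n - 2 * k + 1) * a)) ≤ 2 * min 1 (2.3 / √((n - k - 1) * a * c)) := by
    rw [mul_min_of_nonneg _ _ (by norm_num)]
    refine le_min ((min_le_left _ _).trans (by norm_num)) ((min_le_right _ _).trans ?_)
    have hs : 0 < (n - 2 * k + 1) * a := mul_pos (by linarith) ha
    have ht : 0 < (n - k - 1) * a * c := mul_pos (mul_pos (by linarith) ha) hc0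
    -- The ratio 1.5 suffices because n ≥ 4k, and 3 · 1.5 = 4.5 stays below 2 · 2.3.
    have hst : (n - k - 1) * a * c ≤ 1.5 ^ 2 * ((n - 2 * k + 1) * a) := by
      calc (n - k - 1) * a * c ≤ (n - k - 1) * a :=
            mul_le_of_le_one_right (mul_pos (by linarith) ha).le hc1
        _ ≤ _ := by
          rw [← mul_assoc]
          exact mul_le_mul_of_nonneg_right (by linarith) ha.le
    have hsq := Real.sqrt_le_sqrt hst
    rw [Real.sqrt_mul (by norm_num : (0 : ℝ) ≤ 1.5 ^ 2), Real.sqrt_sq (by norm_num)] at hsq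
    rw [mul_div_assoc', div_le_div_iff₀ (Real.sqrt_pos.mpr hs) (Real.sqrt_pos.mpr ht)]
    have := Real.sqrt_nonneg ((n - 2 * k + 1) * a)
    linarith
  calc _ ≤ (k - 1) * a * (2 * min 1 (2.3 / √((n - k - 1) * a * c))) :=
        mul_le_mul_of_nonneg_left h1 (mul_nonneg (by linarith) ha.le)
    _ = _ := by ring

theorem tail_bound_arith {α r l m P K : ℝ} (hα : 0 < α) (hr0 : 0 < r) (hr1 : r < 1)
    (hmean : α * r = l) (hK : 2 ≤ K) (hαK : α ≤ K + 1) (hm : min 2 (4.6 / √l) ≤ m)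
    (h1 : P ≤ l ^ 2 / (K * (K + 1))) (h2 : P ≤ r / (α * (1 - r))) :
    P ≤ 4 * r ^ 2 / (1 - r) * m := by
  have hq : 0 < 1 - r := by linarith
  have hl : 0 < l := by rw [← hmean]; positivity
  have hsl : 0 < √l := Real.sqrt_pos.mpr hl
  -- The threshold 9 makes 4.6/√l ≥ 3/2 below it, where the factorial moment gives 3r²/2; above it
  -- Chebyshev gives r²/(1-r) · 1/l and 1/l ≤ m.
  rcases le_total l 9 with h | h
  · have hs3 : √l ≤ 3 := by
      rw [show (3 : ℝ) = √9 by rw [show (9 : ℝ) = 3 ^ 2 by norm_num, Real.sqrt_sq (by norm_num)]]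
      exact Real.sqrt_le_sqrt h
    have hm1 : 3 / 2 ≤ m := by
      refine le_trans (le_min (by norm_num) ?_) hm
      rw [le_div_iff₀ hsl]; linarith
    have hP : P ≤ 3 / 2 * r ^ 2 := by
      refine h1.trans ?_
      rw [div_le_iff₀ (by positivity), ← hmean]
      have : α ^ 2 ≤ 3 / 2 * (K * (K + 1)) := by nlinarith
      have := mul_le_mul_of_nonneg_right this (sq_nonneg r)
      linarith
    have h4 : 4 * r ^ 2 ≤ 4 * r ^ 2 / (1 - r) := by
      rw [le_div_iff₀ hq]; nlinarith [sq_nonneg r]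
    nlinarith [sq_nonneg r]
  · have hm1 : 1 / l ≤ m := by
      refine le_trans (le_min ?_ ?_) hm
      · rw [div_le_iff₀ hl]; linarith
      · rw [div_le_div_iff₀ hl hsl]
        have h5 : √l * √l = l := Real.mul_self_sqrt hl.le
        have : 1 ≤ √l := by
          rw [Real.one_le_sqrt]; linarith
        nlinarith
    calc P ≤ r / (α * (1 - r)) := h2
      _ = r ^ 2 / (1 - r) * (1 / l) := by rw [← hmean]; field_simp
      _ ≤ r ^ 2 / (1 - r) * m := mul_le_mul_of_nonneg_left hm1 (by positivity)
      _ ≤ 4 * r ^ 2 / (1 - r) * m := by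
        refine mul_le_mul_of_nonneg_right ?_ ((by positivity : (0 : ℝ) ≤ 1 / l).trans hm1)
        refine div_le_div_of_nonneg_right ?_ hq.le
        nlinarith [sq_nonneg r]

theorem stein_bound_arith {k n a α r P K c : ℝ} (hk : 2 ≤ k) (hn : 4 * k ≤ n) (ha : 0 < a)
    (hα : 0 < α) (hr1 : r < 1) (hmean : α * r = n * a) (hr : r = (2 * k - 1) * a) (hK : 2 ≤ K)
    (hKα : K ≤ α) (hαK : α ≤ K + 1) (hc0 : 0 < c) (hc1 : c ≤ 1)
    (h1 : P ≤ (n * a) ^ 2 / (K * (K + 1))) (h2 : P ≤ r / (α * (1 - r))) :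
    n * a ^ 3 * (k * (k - 1)) * (1 / (K * r * (1 - r))) * min 1 (3 / √((n - 4 * k + 2) * a)) + P ≤
      n * a ^ 2 / (K * r * (1 - r)) * (2 * k - 1) * (2 * (4 * k - 3) * a + r) *
        min 2 (4.6 / √((n - 4 * k + 2) * a * c)) := by
  have hq : 0 < 1 - r := by linarith
  have hr0 : 0 < r := by rw [hr]; exact mul_pos (by linarith) ha
  have hn0 : 0 < n := by linarith
  have hs : 0 < (n - 4 * k + 2) * a := mul_pos (by linarith) ha
  have hsc : 0 < (n - 4 * k + 2) * a * c := mul_pos hs hc0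
  have hscs : (n - 4 * k + 2) * a * c ≤ (n - 4 * k + 2) * a := mul_le_of_le_one_right hs.le hc1
  have hl : (n - 4 * k + 2) * a ≤ n * a := mul_le_mul_of_nonneg_right (by linarith) ha.le
  set m := min 2 (4.6 / √((n - 4 * k + 2) * a * c)) with hm
  have hδm : min 1 (3 / √((n - 4 * k + 2) * a)) ≤ m := by
    have := Real.sqrt_pos.mpr hsc
    have := Real.sqrt_le_sqrt hscs
    refine min_le_min (by norm_num) ?_
    exact div_le_div₀ (by norm_num) (by norm_num) ‹_› ‹_›
  have hlm : min 2 (4.6 / √(n * a)) ≤ m := by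
    have := Real.sqrt_pos.mpr hsc
    have := Real.sqrt_le_sqrt (hscs.trans hl)
    refine min_le_min le_rfl ?_
    exact div_le_div_of_nonneg_left (by norm_num) ‹_› ‹_›
  have hP := tail_bound_arith hα hr0 hr1 hmean hK hαK hlm h1 h2
  have hm0 : 0 ≤ m := by positivity
  set w := n * a ^ 2 / (K * r * (1 - r)) with hw
  have hKr : 0 < K * r * (1 - r) := by positivity
  have hw0 : 0 ≤ w := by positivity
  have hwr : r / (1 - r) ≤ w * (2 * k - 1) := by
    have e : w * (2 * k - 1) = α * r / (K * (1 - r)) := by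
      rw [hw]
      field_simp
      linear_combination -r * hmean - n * a * hr
    rw [e, div_le_div_iff₀ hq (by positivity)]
    have := mul_le_mul_of_nonneg_right hKα (mul_pos hr0 hq).le
    linarith
  have t1 : n * a ^ 3 * (k * (k - 1)) * (1 / (K * r * (1 - r))) *
      min 1 (3 / √((n - 4 * k + 2) * a)) ≤ w * a * (k * (k - 1)) * m := by
    have e : n * a ^ 3 * (k * (k - 1)) * (1 / (K * r * (1 - r))) = w * a * (k * (k - 1)) := by
      rw [hw]; ring
    rw [e]
    exact mul_le_mul_of_nonneg_left hδm (mul_nonneg (by positivity)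
      (mul_nonneg (by linarith) (by linarith)))
  have t2 : P ≤ w * a * (4 * (2 * k - 1) ^ 2) * m := by
    refine hP.trans (mul_le_mul_of_nonneg_right ?_ hm0)
    calc 4 * r ^ 2 / (1 - r) = (4 * r) * (r / (1 - r)) := by ring
      _ ≤ (4 * r) * (w * (2 * k - 1)) := mul_le_mul_of_nonneg_left hwr (by positivity)
      _ = _ := by rw [hr]; ring
  -- Here 10k - 7 = 2(4k-3) + (2k-1), and the difference of the two sides is wam(3k² - 7k + 3),
  -- where the quadratic is positive for k ≥ 2.
  have t3 : w * a * (k * (k - 1) + 4 * (2 * k - 1) ^ 2) * m ≤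
      w * a * ((2 * k - 1) * (10 * k - 7)) * m := by
    refine mul_le_mul_of_nonneg_right (mul_le_mul_of_nonneg_left ?_ (by positivity)) hm0
    nlinarith
  calc _ ≤ w * a * (k * (k - 1) + 4 * (2 * k - 1) ^ 2) * m := by linarith
    _ ≤ w * a * ((2 * k - 1) * (10 * k - 7)) * m := t3
    _ = _ := by rw [hr]; ring

end Arithmetic

/-! ### Assembly. -/

theorem mainTheorem11
    {Ω Ω' : Type*} [MeasurableSpace Ω] [MeasurableSpace Ω']
    (μ : Measure Ω) [IsProbabilityMeasure μ] (ν : Measure Ω') [IsProbabilityMeasure ν]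
    (k₁ k₂ n : ℕ) (p α pc : ℝ)
    (hk : (1 ≤ k₁ ∧ 1 ≤ k₂) ∨ k₁ + k₂ = 1) (hn : 4 * (k₁ + k₂) ≤ n)
    (ξ : ℕ → Ω → ℕ)
    (hξ_meas : ∀ l ∈ Finset.Icc 1 n, Measurable (ξ l))
    (hξ_indep : iIndepFun (fun l : Finset.Icc 1 n => ξ l) μ)
    (hξ_one : ∀ l ∈ Finset.Icc 1 n, μ.real {ω | ξ l ω = 1} = p)
    (hξ_zero : ∀ l ∈ Finset.Icc 1 n, μ.real {ω | ξ l ω = 0} = 1 - p)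
    (B M : Ω → ℕ)
    (hB : B = fun ω => runCount k₁ k₂ n (fun l => ξ l ω))
    (hM : M = fun ω => cyclicRunCount k₁ k₂ n (fun l => ξ l ω))
    (hα : 0 < α) (hpc_pos : 0 < pc) (hpc_lt : pc < 1)
    (h_mean : α * pc = ∫ ω, (M ω : ℝ) ∂μ)
    (h_var : α * pc * (1 - pc) = variance (fun ω => (M ω : ℝ)) μ)
    (Z : Ω' → ℕ) (hZ_meas : Measurable Z)
    (hZ : ∀ m : ℕ, ν.real {ω | Z ω = m} = pseudoBinomialPMF α pc m)
    (k a : ℝ) (hk_def : k = (k₁ : ℝ) + (k₂ : ℝ)) (ha : a = (1 - p) ^ k₁ * p ^ k₂) :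
    dTV μ B ν Z ≤ dTV μ B μ M + dTV μ M ν Z ∧
    dTV μ B μ M + dTV μ M ν Z ≤
      2 * (k - 1) * a *
          min 1 (2.3 / √(((n : ℝ) - k - 1) * a * (2 * p ^ 3 - p ^ 4))) +
        (n : ℝ) * a ^ 2 / ((⌊α⌋ : ℝ) * pc * (1 - pc)) * (2 * k - 1) *
            (2 * (4 * k - 3) * a + pc) *
          min 2 (4.6 / √(((n : ℝ) - 4 * k + 2) * a * (2 * p ^ 3 - p ^ 4))) := by
  refine ⟨dTV_triangle μ B μ M ν Z, ?_⟩
  obtain ⟨y, hy, hper, hξy⟩ := exists_isBernoulliTrials (by omega) hξ_meas hξ_indep hξ_one hξ_zero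
  set K := k₁ + k₂ with hKdef
  have hK1 : 1 ≤ K := by omega
  have hkK : k = (K : ℝ) := by rw [hk_def, hKdef]; push_cast; rfl
  have hn1 : 1 ∈ Finset.Icc 1 n := Finset.mem_Icc.mpr (by omega)
  have hp0 : 0 ≤ p := by rw [← hξ_one 1 hn1]; exact measureReal_nonneg
  have hp1 : p ≤ 1 := by
    have : (0 : ℝ) ≤ 1 - p := by rw [← hξ_zero 1 hn1]; exact measureReal_nonneg
    linarith
  -- the laws of the two counts
  have hBy : B =ᵐ[μ] fun ω => shiftedRunCount k₁ k₂ (fun j => y j ω) 0 n := by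
    filter_upwards [hξy] with ω hω
    rw [hB]
    simp only [runCount, shiftedRunCount]
    rw [← hKdef, ← Finset.Ico_add_one_right_eq_Icc, Finset.sum_Ico_eq_sum_range,
      Nat.add_sub_cancel]
    refine Finset.sum_congr rfl fun i hi => ?_
    rw [Finset.mem_range] at hi
    rw [zero_add]
    refine runIndicator_congr fun j hj => ?_
    rw [← hω, Nat.mod_eq_of_lt (by omega), Nat.sub_add_cancel (by omega)]
  have hMy : M =ᵐ[μ] fun ω => ∑ l ∈ Finset.Icc 1 n, runIndicator k₁ k₂ (fun j => y j ω) l := by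
    filter_upwards [hξy] with ω hω
    rw [hM]
    simp only [cyclicRunCount]
    refine Finset.sum_congr rfl fun l _ => runIndicator_congr fun i _ => hω _
  have hBmeas : AEMeasurable B μ := ⟨_, hy.measurable_shiftedRunCount 0 n, hBy⟩
  have hMmeas : AEMeasurable M μ :=
    ⟨_, Finset.measurable_fun_sum _ fun l _ => hy.measurable_runIndicator l, hMy⟩
  have hBlaw : ∀ f : ℕ → ℝ, ∫ ω, f (B ω) ∂μ = pairing f (runPoly a K n) := fun f => by
    rw [ha, ← hy.integral_apply_shiftedRunCount hk 0 le_rfl f]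
    exact integral_congr_ae (hBy.fun_comp f)
  have hMlaw : ∀ f : ℕ → ℝ, ∫ ω, f (M ω) ∂μ = pairing f (cyclicRunPoly a K n) := fun f => by
    rw [ha, ← hy.integral_apply_cyclic_sum hk (by omega) hper f]
    exact integral_congr_ae (hMy.fun_comp f)
  have hLnn : ∀ N ≤ n, ∀ m, 0 ≤ (runPoly a K N).coeff m := fun N hN m => by
    rw [← pairing_single, ha, ← hy.integral_apply_shiftedRunCount hk 0 hN]
    exact integral_nonneg fun ω => by dsimp only; split_ifs <;> norm_num
  have hTnn : ∀ m, 0 ≤ (cyclicRunPoly a K n).coeff m := fun m => by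
    rw [← pairing_single, ← hMlaw]
    exact integral_nonneg fun ω => by dsimp only; split_ifs <;> norm_num
  -- the parameters
  have hmean : α * pc = n * a := by
    rw [h_mean, hMlaw fun m => (m : ℝ), ← eval_one_derivative_cyclicRunPoly hK1 (by omega)]
    have := pairing_cast_mul (fun _ => 1) (cyclicRunPoly a K n)
    rw [pairing_const] at this
    simpa using this
  have hn0 : (0 : ℝ) < n := by exact_mod_cast (show 0 < n by omega)
  have ha0 : 0 < a := by
    have : 0 < n * a := by rw [← hmean]; positivity
    exact pos_of_mul_pos_right this hn0.le
  have hpc : pc = (2 * K - 1) * a := by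
    have hmeas' : AEMeasurable (fun ω => (M ω : ℝ)) μ :=
      (measurable_of_countable (fun m : ℕ => (m : ℝ))).comp_aemeasurable hMmeas
    rw [variance_eq_integral hmeas', ← h_mean, hmean,
      hMlaw fun m => ((m : ℝ) - n * a) ^ 2,
      ← eval_one_derivative_cyclicRunPoly (a := a) hK1 (show K ≤ n by omega),
      pairing_sq_sub_mean (eval_one_cyclicRunPoly hK1), pgfVariance_cyclicRunPoly hK1 (by omega),
      eval_one_derivative_cyclicRunPoly hK1 (by omega)] at h_var
    have := mul_left_cancel₀ (by positivity) h_var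
    linarith
  have hK1' : (1 : ℝ) ≤ K := by exact_mod_cast hK1
  have hnK : (4 * K : ℝ) ≤ n := by exact_mod_cast hn
  have hαn : α * (2 * K - 1) = n := by
    rw [hpc] at hmean
    exact mul_right_cancel₀ ha0.ne' (by linarith)
  -- From α(2k-1) = n ≥ 4k; the tail estimate needs ⌊α⌋ ≥ 2.
  have hα2 : 2 ≤ α := by nlinarith
  have hfloor2 : 2 ≤ ⌊α⌋₊ := Nat.le_floor (by exact_mod_cast hα2)
  have hfloor : ((⌊α⌋ : ℤ) : ℝ) = (⌊α⌋₊ : ℝ) := (natCast_floor_eq_intCast_floor hα.le).symm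
  have hKα : (⌊α⌋₊ : ℝ) ≤ α := Nat.floor_le hα.le
  have hαK : α ≤ ⌊α⌋₊ + 1 := (Nat.lt_floor_add_one α).le
  have hka : 2 ≤ K → (2 * K - 1) * a ≤ 8 / 9 := fun h2 => by
    rw [ha]
    have h12 : 1 ≤ k₁ ∧ 1 ≤ k₂ := by omega
    exact mul_pow_mul_pow_le h12.1 h12.2 hp0 hp1
  -- the two total variation distances
  have hind0 : ∀ (S : Set ℕ) (m : ℕ), (0 : ℝ) ≤ S.indicator 1 m := fun S m =>
    Set.indicator_nonneg (fun _ _ => zero_le_one) m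
  have hind1 : ∀ (S : Set ℕ) (m : ℕ), S.indicator (1 : ℕ → ℝ) m ≤ 1 := fun S m =>
    Set.indicator_le_self' (fun _ _ => zero_le_one) m
  have hBM : dTV μ B μ M ≤ (k - 1) * a * min 1 (3 / √(((n : ℝ) - 2 * k + 1) * a)) := by
    refine dTV_le fun S _ => ?_
    rw [measureReal_preimage_eq_integral hBmeas, measureReal_preimage_eq_integral hMmeas,
      hBlaw, hMlaw, hkK]
    exact abs_pairing_runPoly_sub_cyclicRunPoly_le ha0 hK1 (by omega) hka (hLnn _ (by omega))
      (hind0 S) (hind1 S)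
  have hMZ : dTV μ M ν Z ≤ n * a ^ 3 * (k * (k - 1)) * (1 / (⌊α⌋₊ * pc * (1 - pc)))
      * min 1 (3 / √(((n : ℝ) - 4 * k + 2) * a))
      + pairing (fun m => if ⌊α⌋₊ < m then 1 else 0) (cyclicRunPoly a K n) := by
    refine dTV_le fun S _ => ?_
    rw [measureReal_preimage_eq_integral hMmeas, hMlaw, measureReal_preimage_eq_sum hZ_meas hZ
      (sum_pseudoBinomialPMF hα hpc_pos hpc_lt), hkK]
    exact abs_pairing_cyclicRunPoly_sub_pseudoBinomial_le ha0 hK1 hn hka hLnn hTnn hα hpc_pos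
      hpc_lt (by omega) hmean hpc (hind0 S) (hind1 S)
  refine (add_le_add hBM hMZ).trans ?_
  rw [hfloor]
  rcases Nat.lt_or_ge K 2 with hK2 | hK2
  · have hK : K = 1 := by omega
    have hk1 : k = 1 := by rw [hkK, hK]; norm_num
    -- For k = 1 the matching gives α = n, which M never exceeds; the remaining terms carry a factor
    -- k - 1 = 0.
    have htail : pairing (fun m => if ⌊α⌋₊ < m then (1 : ℝ) else 0) (cyclicRunPoly a K n) = 0 := by
      rw [← hMlaw]
      refine integral_eq_zero_of_ae ?_
      filter_upwards [hMy] with ω hω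
      have hle : M ω ≤ n := by
        rw [hω]
        refine (Finset.sum_le_sum fun l _ => runIndicator_le_one (fun j => hy.le_one j ω) l).trans ?_
        simp
      have : ⌊α⌋₊ = n := by
        have : α = n := by rw [← hαn, hK]; norm_num
        rw [this, Nat.floor_natCast]
      rw [this, if_neg (by omega)]; rfl
    rw [htail, hk1]
    have hq : 0 < 1 - pc := by linarith
    norm_num
    positivity
  · have hk2 : 2 ≤ k := by rw [hkK]; exact_mod_cast hK2
    have hk₂ : k₂ ≠ 0 := by omega
    have hp : 0 < p := by
      refine lt_of_le_of_ne hp0 fun h => ha0.ne' ?_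
      rw [ha, ← h, zero_pow hk₂, mul_zero]
    have hc0 : 0 < 2 * p ^ 3 - p ^ 4 := by
      have : 2 * p ^ 3 - p ^ 4 = p ^ 3 * (2 - p) := by ring
      rw [this]
      exact mul_pos (by positivity) (by linarith)
    have hc1 : 2 * p ^ 3 - p ^ 4 ≤ 1 := by
      have h3 : p ^ 3 ≤ p := by simpa using pow_le_pow_of_le_one hp0 hp1 (show 1 ≤ 3 by norm_num)
      have := mul_le_mul_of_nonneg_right h3 (by linarith : 0 ≤ 2 - p)
      nlinarith [sq_nonneg (p - 1)]
    rw [← hkK] at hnK hpc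
    have hb := boundary_bound_arith (by linarith) hnK ha0 hc0 hc1
    have hs := stein_bound_arith hk2 hnK ha0 hα hpc_lt hmean hpc
      (by exact_mod_cast hfloor2 : (2 : ℝ) ≤ ⌊α⌋₊) hKα hαK hc0 hc1
      (pairing_tail_cyclicRunPoly_le_sq hK1 (by omega) ha0 hTnn (by omega))
      (pairing_tail_cyclicRunPoly_le_chebyshev hK1 (by omega) hTnn hα hpc_pos hpc_lt hmean
        (by rw [hpc, hkK]))
    exact add_le_add hb hs
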